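/- Let $d\ge 1$ and $0<\delta<1$. Let $\Omega=(\{0,1\}^d)^{\mathbb Z}$ with the product $\mathbb P$ of the uniform probability measures on $\{0,1\}^d$, and write $\mathbb E_\omega$ for the expectation with respect to $\mathbb P$. For $\omega\in\Omega$ let $\mathcal D_\omega$ be the dyadic grid consisting of the cubes $$2^k\big([p_1,p_1+1)\times\cdots\times[p_d,p_d+1)\big)+\sum_{j<k}\omega_j2^j,\qquad k\in\mathbb Z,\ p\in\mathbb Z^d,$$ of side length $\ell(Q)=2^k$. A Haar function associated with $Q\in\mathcal D_\omega$ is any real linear combination of the indicator functions of the $2^d$ cubes $R\in\mathcal D_\omega$ with $R\subset Q$ and $\ell(R)=\ell(Q)/2$. For integers $m,n\ge 0$, a bounded linear operator $\mathbb S$ on $L^2(\mathbb R^d)$ (real-valued functions) is a Haar shift on $\mathcal D_\omega$ of complexity type $(m,n)$ if $$\mathbb S f=\sum_{Q\in\mathcal D_\omega}\frac1{|Q|}\sum_{\substack{Q',Q''\in\mathcal D_\omega,\ Q',Q''\subset Q\\ \ell(Q')=2^{-m}\ell(Q),\ \ell(Q'')=2^{-n}\ell(Q)}}\langle f,h^{Q'}_{Q''}\rangle\,h^{Q''}_{Q'},\qquad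 f\in L^2(\mathbb R^d),$$ where $h^{Q'}_{Q''}$ and $h^{Q''}_{Q'}$ are Haar functions associated with $Q''$ and $Q'$ respectively, satisfying $|h^{Q'}_{Q''}(y)\,h^{Q''}_{Q'}(x)|\le 1$ for all $x,y\in\mathbb R^d$; the series is summed by scales, that is, the partial sums over $2^{-N}\le\ell(Q)\le 2^N$ converge to $\mathbb Sf$ weakly in $L^2$ as $N\to\infty$. There is a constant $C>0$, depending only on $d$ and $\delta$, such that the following holds. For all $m,n\ge 0$ and $\omega\in\Omega$ let $\lambda^\omega_{m,n}\in\mathbb R$ with $|\lambda^\omega_{m,n}|\le 2^{-(m+n)\delta}$, and let $\mathbb S^\omega_{m,n}$ be a Haar shift on $\mathcal D_\omega$ of complexity type $(m,n)$ with $\|\mathbb S^\omega_{m,n}\|_{L^2\to L^2}\le 1$, such that $\omega\mapsto\sum_{m,n}\lambda^\omega_{m,n}\langle\mathbb S^\omega_{m,n}f,g\rangle$ is $\mathbb P$-measurable for all $f,g\in L^2(\mathbb R^d)$. Then there is a bounded linear operator $S$ on $L^2(\mathbb R^d)$ with $$\langle Sf,g\rangle=\mathbb E_\omega\sum_{m,n\ge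 0}\lambda^\omega_{m,n}\langle\mathbb S^\omega_{m,n}f,g\rangle,\qquad f,g\in L^2(\mathbb R^d),$$ and $S$ is a Calderón–Zygmund operator with exponent $\delta$: there is a real-valued function $K$ on $\{(x,y)\in\mathbb R^d\times\mathbb R^d: x\ne y\}$ such that $$|K(x,y)|\le\frac{C}{|x-y|^d}\quad\text{for } x\ne y,$$ $$|K(x,y)-K(x',y)|+|K(y,x)-K(y,x')|\le C\,\frac{|x-x'|^\delta}{|x-y|^{\delta+d}}\quad\text{whenever } x\neq y,\ |x-x'|<\tfrac12|x-y|,$$ and $$\langle Sf,g\rangle=\iint f(y)g(x)K(x,y)\,dx\,dy$$ (an absolutely convergent integral) for all bounded measurable $f,g:\mathbb R^d\to\mathbb R$ with compact and disjoint supports. -/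

import Mathlib

open MeasureTheory Filter Topology

noncomputable section

namespace HaarShift

/-- The space `({0,1}^d)^ℤ` of doubly infinite sequences of binary `d`-tuples. -/
abbrev Omega (d : ℕ) : Type := ℤ → Fin d → Bool

/-- The product over `ℤ` of the uniform probability measure on `{0,1}^d`. -/
def prob (d : ℕ) : Measure (Omega d) :=
  Measure.infinitePi fun _ : ℤ => (PMF.uniformOfFintype (Fin d → Bool)).toMeasure

/-- The `i`-th coordinate of the translation vector `∑_{j < k} ω_j 2^j`. -/
def gridShift {d : ℕ} (ω : Omega d) (k : ℤ) (i : Fin d) : ℝ :=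
  ∑' j : {j : ℤ // j < k}, if ω j.1 i then (2 : ℝ) ^ j.1 else 0

/-- The names of the cubes of a dyadic grid: `⟨k, p⟩` names the standard dyadic cube
`2^k ([p_1, p_1 + 1) × ⋯ × [p_d, p_d + 1))` and its translates. -/
@[ext]
structure Cube (d : ℕ) where
  /-- The exponent `k` of the side length `2^k`. -/
  scale : ℤ
  /-- The position `p`. -/
  pos : Fin d → ℤ

/-- The side length. -/
def Cube.side {d : ℕ} (Q : Cube d) : ℝ := (2 : ℝ) ^ Q.scale

/-- The cube `Q + ω` of the grid `𝒟_ω`, as a set of points. -/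
def Cube.toSet {d : ℕ} (ω : Omega d) (Q : Cube d) : Set (EuclideanSpace ℝ (Fin d)) :=
  {x | ∀ i, Q.side * Q.pos i + gridShift ω Q.scale i ≤ x i ∧
    x i < Q.side * (Q.pos i + 1) + gridShift ω Q.scale i}

theorem descendants_finite {d : ℕ} (ω : Omega d) (m : ℕ) (Q : Cube d) :
    {R : Cube d | R.scale = Q.scale - m ∧ R.toSet ω ⊆ Q.toSet ω}.Finite := by
  have h2 : (0 : ℝ) < (2 : ℝ) ^ (Q.scale - m) := by positivity
  let s : Fin d → ℝ := gridShift ω (Q.scale - m)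
  let t : Fin d → ℝ := gridShift ω Q.scale
  let lo : Fin d → ℤ := fun i => ⌊(Q.side * Q.pos i + t i - s i) / (2 : ℝ) ^ (Q.scale - m)⌋
  let hi : Fin d → ℤ := fun i =>
    ⌈(Q.side * (Q.pos i + 1) + t i - s i) / (2 : ℝ) ^ (Q.scale - m)⌉
  refine ((Set.finite_Icc lo hi).image fun p => (⟨Q.scale - m, p⟩ : Cube d)).subset ?_
  rintro ⟨k, p⟩ ⟨hk, hR⟩
  dsimp only at hk
  subst hk
  have hx : (WithLp.toLp 2 fun i => (2 : ℝ) ^ (Q.scale - m) * p i + s i) ∈ Q.toSet ω := by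
    apply hR
    intro i
    simp only [Cube.side]
    refine ⟨le_rfl, ?_⟩
    show (2 : ℝ) ^ (Q.scale - m) * p i + s i < (2 : ℝ) ^ (Q.scale - m) * (p i + 1) + s i
    linarith
  refine ⟨p, ⟨fun i => ?_, fun i => ?_⟩, rfl⟩
  · have h := (hx i).1
    have h' : Q.side * Q.pos i + t i ≤ (2 : ℝ) ^ (Q.scale - m) * p i + s i := h
    have : (Q.side * Q.pos i + t i - s i) / (2 : ℝ) ^ (Q.scale - m) ≤ p i := by
      rw [div_le_iff₀ h2]; linarith
    exact Int.cast_le.mp ((Int.floor_le _).trans this)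
  · have h := (hx i).2
    have h' : (2 : ℝ) ^ (Q.scale - m) * p i + s i < Q.side * (Q.pos i + 1) + t i := h
    have : (p i : ℝ) ≤ (Q.side * (Q.pos i + 1) + t i - s i) / (2 : ℝ) ^ (Q.scale - m) := by
      rw [le_div_iff₀ h2]; linarith
    exact Int.cast_le.mp (this.trans (Int.le_ceil _))

/-- The cubes `R ∈ 𝒟_ω` with `R ⊆ Q` and side length `2^{-m}` times that of `Q`;
for `m = 1` these are the children of `Q`. -/
def descendants {d : ℕ} (ω : Omega d) (m : ℕ) (Q : Cube d) : Finset (Cube d) :=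
  (descendants_finite ω m Q).toFinset

/-- `h` is a Haar function associated with `Q`: a linear combination of the indicators of the
children of `Q` (no cancellation is required). -/
def IsHaarFunction {d : ℕ} (ω : Omega d) (Q : Cube d) (h : EuclideanSpace ℝ (Fin d) → ℝ) : Prop :=
  ∃ c : Cube d → ℝ, ∀ x, h x = ∑ R ∈ descendants ω 1 Q, c R * (R.toSet ω).indicator 1 x

/-- The part of the series of a Haar shift that belongs to the cubes `Q` of side length `2^k`.
Here `hin Q' Q''` is the Haar function on `Q''` against which `f` is integrated and
`hout Q' Q''` is the Haar function on `Q'`. For each `x` at most one term of the outer sum is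
nonzero. -/
def scalePart {d : ℕ} (ω : Omega d) (m n : ℕ)
    (hin hout : Cube d → Cube d → EuclideanSpace ℝ (Fin d) → ℝ) (k : ℤ)
    (f : EuclideanSpace ℝ (Fin d) → ℝ) (x : EuclideanSpace ℝ (Fin d)) : ℝ :=
  ∑' p : Fin d → ℤ, (1 / (Cube.mk k p).side ^ d) *
    ∑ Q' ∈ descendants ω m ⟨k, p⟩, ∑ Q'' ∈ descendants ω n ⟨k, p⟩,
      (∫ y, f y * hin Q' Q'' y) * hout Q' Q'' x

/-- `S` is a Haar shift on `𝒟_ω` of complexity type `(m, n)`. The series over the cubes `Q` is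
summed in the order of the scales and converges to `S f` weakly in `L²`. -/
def IsHaarShift {d : ℕ} (ω : Omega d) (m n : ℕ)
    (S : Lp ℝ 2 (volume : Measure (EuclideanSpace ℝ (Fin d))) →L[ℝ]
      Lp ℝ 2 (volume : Measure (EuclideanSpace ℝ (Fin d)))) : Prop :=
  ∃ hin hout : Cube d → Cube d → EuclideanSpace ℝ (Fin d) → ℝ,
    (∀ Q : Cube d, ∀ Q' ∈ descendants ω m Q, ∀ Q'' ∈ descendants ω n Q,
      IsHaarFunction ω Q'' (hin Q' Q'') ∧ IsHaarFunction ω Q' (hout Q' Q'') ∧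
      ∀ x y, |hin Q' Q'' y * hout Q' Q'' x| ≤ 1) ∧
    ∀ f g : Lp ℝ 2 (volume : Measure (EuclideanSpace ℝ (Fin d))),
      Tendsto
        (fun N : ℕ => ∫ x, (∑ k ∈ Finset.Icc (-(N : ℤ)) N, scalePart ω m n hin hout k f x) * g x)
        atTop (𝓝 (inner ℝ (S f) g))

/-- `K` is a standard kernel with constant `C` and smoothness exponent `δ`. The values of `K` on
the diagonal are irrelevant. -/
structure IsStandardKernel {d : ℕ} (C δ : ℝ)
    (K : EuclideanSpace ℝ (Fin d) → EuclideanSpace ℝ (Fin d) → ℝ) : Prop where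
  size : ∀ x y, x ≠ y → |K x y| ≤ C / ‖x - y‖ ^ d
  smooth : ∀ x x' y, x ≠ y → ‖x - x'‖ < ‖x - y‖ / 2 →
    |K x y - K x' y| + |K y x - K y x'| ≤ C * ‖x - x'‖ ^ δ / ‖x - y‖ ^ (δ + d)

/-- The bounded operator `T` on `L²` is represented by `K` off the diagonal. -/
def IsRepresentedBy {d : ℕ}
    (T : Lp ℝ 2 (volume : Measure (EuclideanSpace ℝ (Fin d))) →L[ℝ]
      Lp ℝ 2 (volume : Measure (EuclideanSpace ℝ (Fin d))))
    (K : EuclideanSpace ℝ (Fin d) → EuclideanSpace ℝ (Fin d) → ℝ) : Prop :=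
  ∀ (f g : EuclideanSpace ℝ (Fin d) → ℝ) (hf : MemLp f 2 volume) (hg : MemLp g 2 volume),
    (∃ B, ∀ x, |f x| ≤ B) → (∃ B, ∀ x, |g x| ≤ B) →
    HasCompactSupport f → HasCompactSupport g → Disjoint (tsupport f) (tsupport g) →
    Integrable (fun p : EuclideanSpace ℝ (Fin d) × EuclideanSpace ℝ (Fin d) =>
      f p.2 * g p.1 * K p.1 p.2) (volume.prod volume) ∧
    inner ℝ (T (hf.toLp f)) (hg.toLp g) = ∫ y, ∫ x, f y * g x * K x y

/-- `T` is a Calderón–Zygmund operator with kernel constant `C` and smoothness exponent `δ`. -/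
def IsCalderonZygmund {d : ℕ} (C δ : ℝ)
    (T : Lp ℝ 2 (volume : Measure (EuclideanSpace ℝ (Fin d))) →L[ℝ]
      Lp ℝ 2 (volume : Measure (EuclideanSpace ℝ (Fin d)))) : Prop :=
  ∃ K : EuclideanSpace ℝ (Fin d) → EuclideanSpace ℝ (Fin d) → ℝ,
    IsStandardKernel C δ K ∧ IsRepresentedBy T K

end HaarShift

end

/-
On `{x ≠ y}` the operator `∑ λ S` on the grid `𝒟_ω` has a kernel `K_ω`. Its part of complexity type
`(m, n)` and scale `2^k` is at most `2^{-(m+n)δ} 2^{-kd}`, vanishes unless `|x - y| ≤ d 2^k`, and is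
constant in `x` on cubes of side length `2^{k-m-1}`. Summation over `m`, `n` and `k` gives the size
bound uniformly in `ω`. The part changes between `x` and `x'` only if a face of a cube of side
length `2^{k-m-1}` separates them, and for a random grid this has probability at most of order
`min(1, |x - x'| 2^{m-k})`. Since `δ < 1`, the sum of `2^{-mδ} min(1, u 2^m)` over `m` is of order
`u^δ`. Hence the oscillation of `K_ω` has expectation of order `|x - x'|^δ / |x - y|^{d+δ}`, and
`K = 𝔼 K_ω` is a standard kernel.

Only the pairings `⟨∑ λ S f, g⟩` are assumed to be measurable in `ω`. Because `K_ω` is uniformly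
continuous in mean, `K_ω(x, y)` is a limit in measure of such pairings with bump functions, hence
measurable. Joint measurability in `(ω, x, y)` is not available for Fubini's theorem; the
expectation and the integral are exchanged by approximating the integral over `(x, y)` by Riemann
sums, with an error that is small in mean.
-/

noncomputable section

namespace HaarShift

open scoped ENNReal

variable {d : ℕ}

local notation "ℝ^" d:max => EuclideanSpace ℝ (Fin d)

/-- The enumeration `k - 1, k - 2, …` of the integers below `k`, which turns the series defining
`gridShift` into one over `ℕ`. -/
def natEquivLT (k : ℤ) : ℕ ≃ {j : ℤ // j < k} where
  toFun l := ⟨k - 1 - l, by omega⟩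
  invFun j := (k - 1 - j.1).toNat
  left_inv l := by simp
  right_inv j := Subtype.ext <| by have := j.2; dsimp only; omega

theorem gridShift_eq_tsum_nat (ω : Omega d) (k : ℤ) (i : Fin d) :
    gridShift ω k i =
      ∑' l : ℕ, if ω (k - 1 - l) i then (2 : ℝ) ^ (k - 1 - l : ℤ) else 0 := by
  rw [gridShift, ← (natEquivLT k).tsum_eq]
  rfl

theorem gridShift_term_le (ω : Omega d) (k : ℤ) (i : Fin d) (l : ℕ) :
    (if ω (k - 1 - l) i then (2 : ℝ) ^ (k - 1 - l : ℤ) else 0) ≤ 2 ^ (k - 1) * (1 / 2) ^ l := by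
  have h : (2 : ℝ) ^ (k - 1 - l : ℤ) = 2 ^ (k - 1) * (1 / 2) ^ l := by
    rw [zpow_sub₀ two_ne_zero, zpow_natCast, div_eq_mul_inv, one_div, inv_pow]
  rw [← h]
  split_ifs
  · exact le_rfl
  · positivity

theorem summable_gridShift (ω : Omega d) (k : ℤ) (i : Fin d) :
    Summable fun l : ℕ => if ω (k - 1 - l) i then (2 : ℝ) ^ (k - 1 - l : ℤ) else 0 :=
  .of_nonneg_of_le (fun _ => by positivity) (gridShift_term_le ω k i)
    (summable_geometric_two.mul_left _)

theorem gridShift_nonneg (ω : Omega d) (k : ℤ) (i : Fin d) : 0 ≤ gridShift ω k i :=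
  tsum_nonneg fun _ => by positivity

theorem gridShift_le (ω : Omega d) (k : ℤ) (i : Fin d) : gridShift ω k i ≤ 2 ^ k :=
  calc gridShift ω k i
      ≤ ∑' l : ℕ, (2 : ℝ) ^ (k - 1) * (1 / 2) ^ l := by
        rw [gridShift_eq_tsum_nat]
        exact (summable_gridShift ω k i).tsum_le_tsum (gridShift_term_le ω k i)
          (summable_geometric_two.mul_left _)
    _ = 2 ^ k := by
        rw [tsum_mul_left, tsum_geometric_two, ← zpow_add_one₀ two_ne_zero, sub_add_cancel]

theorem measurable_gridShift (k : ℤ) (i : Fin d) :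
    Measurable fun ω : Omega d => gridShift ω k i := by
  refine Measurable.tsum fun j => .ite ?_ measurable_const measurable_const
  have hcoord : Measurable fun ω : Omega d => ω j.1 i :=
    (measurable_pi_apply i).comp (measurable_pi_apply j.1)
  exact hcoord (measurableSet_singleton true)

theorem gridShift_add_one (ω : Omega d) (k : ℤ) (i : Fin d) :
    gridShift ω (k + 1) i = (if ω k i then (2 : ℝ) ^ k else 0) + gridShift ω k i := by
  rw [gridShift_eq_tsum_nat, (summable_gridShift ω (k + 1) i).tsum_eq_zero_add,
    gridShift_eq_tsum_nat]
  congr 1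
  · simp
  · refine tsum_congr fun l => ?_
    have : k + 1 - 1 - ((l + 1 : ℕ) : ℤ) = k - 1 - l := by push_cast; ring
    rw [this]

/-- The integer with binary digits `ω_N, …, ω_{N + n - 1}` in direction `i`. It is the offset,
in units of `2^N`, of the cubes of side length `2^{N + n}` relative to those of side length
`2^N`. -/
def binCode (ω : Omega d) (N : ℤ) (n : ℕ) (i : Fin d) : ℕ :=
  ∑ l ∈ Finset.range n, if ω (N + l) i then 2 ^ l else 0

theorem gridShift_add (ω : Omega d) (N : ℤ) (n : ℕ) (i : Fin d) :
    gridShift ω (N + n) i = 2 ^ N * binCode ω N n i + gridShift ω N i := by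
  induction n with
  | zero => simp [binCode]
  | succ n ih =>
    rw [Nat.cast_succ, ← add_assoc, gridShift_add_one, ih, binCode, binCode,
      Finset.sum_range_succ, zpow_add₀ two_ne_zero, zpow_natCast]
    split_ifs <;> push_cast <;> ring

theorem binCode_lt (ω : Omega d) (N : ℤ) (n : ℕ) (i : Fin d) : binCode ω N n i < 2 ^ n := by
  refine lt_of_le_of_lt (Finset.sum_le_sum (g := fun l => 2 ^ l) fun l _ => ?_)
    (Nat.geomSum_lt le_rfl fun k hk => Finset.mem_range.1 hk)
  split_ifs <;> simp

theorem eq_of_binCode_eq {ω ω' : Omega d} {N : ℤ} {n : ℕ} {i : Fin d}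
    (h : binCode ω N n i = binCode ω' N n i) {l : ℕ} (hl : l < n) :
    ω (N + l) i = ω' (N + l) i := by
  simp only [binCode, ← Finset.sum_filter] at h
  have := Finset.ext_iff.1 (Finset.geomSum_injective le_rfl h) l
  simpa only [Finset.mem_filter, Finset.mem_range, hl, true_and, ← Bool.eq_iff_iff] using this

theorem uniformOfFintype_coord_eq (i : Fin d) (c : Bool) :
    (PMF.uniformOfFintype (Fin d → Bool)).toMeasure {b | b i = c} = 2⁻¹ := by
  obtain ⟨e, rfl⟩ : ∃ e, d = e + 1 := Nat.exists_eq_add_one.2 i.pos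
  have hcard : Fintype.card {b : Fin (e + 1) → Bool // b i = c} = 2 ^ e := by
    have := Fintype.card_filter_piFinset_const_eq_of_mem Finset.univ i (Finset.mem_univ c)
    rw [Fintype.piFinset_univ, Finset.card_univ, Fintype.card_bool, Fintype.card_fin] at this
    rw [Fintype.card_subtype, this, Nat.add_sub_cancel]
  rw [PMF.toMeasure_uniformOfFintype_apply _ (Set.toFinite _).measurableSet]
  simp only [Set.coe_ofPred, hcard, Fintype.card_pi, Fintype.card_bool, Finset.prod_const,
    Finset.card_univ, Fintype.card_fin]
  push_cast
  rw [pow_succ, ENNReal.div_eq_inv_mul, ENNReal.mul_inv (by simp) (by simp), mul_right_comm,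
    ENNReal.inv_mul_cancel (by simp) (by simp), one_mul]

instance : IsProbabilityMeasure (prob d) := by
  unfold prob
  infer_instance

theorem prob_binCode_eq_le (N : ℤ) (n : ℕ) (i : Fin d) (v : ℕ) :
    prob d {ω | binCode ω N n i = v} ≤ 2⁻¹ ^ n := by
  rcases Set.eq_empty_or_nonempty {ω : Omega d | binCode ω N n i = v} with h | ⟨ω₀, h₀⟩
  · simp [h]
  let digits : ℕ ↪ ℤ := ⟨fun l => N + l, fun a b h => by simpa using h⟩
  have hsub : {ω : Omega d | binCode ω N n i = v} ⊆
      Set.pi ((Finset.range n).map digits) fun j => {b | b i = ω₀ j i} := by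
    intro ω hω j hj
    obtain ⟨l, hl, rfl⟩ := Finset.mem_map.1 (Finset.mem_coe.1 hj)
    exact eq_of_binCode_eq (hω.trans h₀.symm) (Finset.mem_range.1 hl)
  refine (measure_mono hsub).trans ?_
  rw [prob, Measure.infinitePi_pi _ fun j _ => (Set.toFinite _).measurableSet]
  simp only [uniformOfFintype_coord_eq, Finset.prod_const, Finset.card_map, Finset.card_range,
    le_refl]

/-- The event that `x` is within distance `r` of a face hyperplane of the cubes of `𝒟_ω` of side
length `2^j`. -/
def nearGrid (x : ℝ^d) (r : ℝ) (j : ℤ) : Set (Omega d) :=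
  {ω | ∃ i, ∃ p : ℤ, |x i - (2 ^ j * p + gridShift ω j i)| ≤ r}

theorem measurableSet_nearGrid (x : ℝ^d) (r : ℝ) (j : ℤ) : MeasurableSet (nearGrid x r j) := by
  simp only [nearGrid, Set.ofPred_exists]
  refine .iUnion fun i => .iUnion fun p => ?_
  have hm : Measurable fun ω : Omega d => |x i - (2 ^ j * p + gridShift ω j i)| :=
    continuous_abs.measurable.comp
      (measurable_const.sub (measurable_const.add (measurable_gridShift j i)))
  exact measurableSet_le hm measurable_const

theorem binCode_mem_of_near {ω : Omega d} {i : Fin d} {t : ℝ} {N : ℤ} {n : ℕ} {p : ℤ}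
    (h : |t - (2 ^ (N + n : ℤ) * p + gridShift ω (N + n) i)| ≤ 2 ^ N) :
    ∃ u ∈ Finset.Icc (⌊t / 2 ^ N⌋ - 2) (⌊t / 2 ^ N⌋ + 1),
      binCode ω N n i = (u % 2 ^ n).toNat := by
  have hpos : (0 : ℝ) < 2 ^ N := by positivity
  set u : ℤ := 2 ^ n * p + binCode ω N n i with hu
  have hmod : u % 2 ^ n = binCode ω N n i := by
    rw [hu, Int.mul_add_emod_self_left]
    exact Int.emod_eq_of_lt (by positivity) (by exact_mod_cast binCode_lt ω N n i)
  have heq : t - (2 ^ (N + n : ℤ) * p + gridShift ω (N + n) i) =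
      t - 2 ^ N * u - gridShift ω N i := by
    rw [gridShift_add, zpow_add₀ two_ne_zero, zpow_natCast, hu]
    push_cast
    ring
  rw [heq, abs_le] at h
  have hshift := gridShift_nonneg ω N i
  have hshift' := gridShift_le ω N i
  have hlower : t / 2 ^ N - 2 ≤ u := by
    rw [sub_le_iff_le_add, div_le_iff₀ hpos]
    linarith
  have hupper : (u : ℝ) ≤ t / 2 ^ N + 1 := by
    rw [← sub_le_iff_le_add, le_div_iff₀ hpos]
    linarith
  have hlower' : ((⌊t / 2 ^ N⌋ - 2 : ℤ) : ℝ) ≤ u := by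
    push_cast
    linarith [Int.floor_le (t / 2 ^ N)]
  have hupper' : (u : ℝ) < (⌊t / 2 ^ N⌋ + 1 + 1 : ℤ) := by
    push_cast
    linarith [Int.lt_floor_add_one (t / 2 ^ N)]
  refine ⟨u, Finset.mem_Icc.2 ⟨Int.cast_le.1 hlower', Int.lt_add_one_iff.1 (Int.cast_lt.1 hupper')⟩,
    ?_⟩
  rw [hmod, Int.toNat_natCast]

theorem prob_near_le_of_dyadic (i : Fin d) (t : ℝ) (N : ℤ) (n : ℕ) :
    prob d {ω | ∃ p : ℤ, |t - (2 ^ (N + n : ℤ) * p + gridShift ω (N + n) i)| ≤ 2 ^ N} ≤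
      4 * 2⁻¹ ^ n :=
  calc prob d {ω | ∃ p : ℤ, |t - (2 ^ (N + n : ℤ) * p + gridShift ω (N + n) i)| ≤ 2 ^ N}
      ≤ prob d (⋃ u ∈ Finset.Icc (⌊t / 2 ^ N⌋ - 2) (⌊t / 2 ^ N⌋ + 1),
          {ω | binCode ω N n i = (u % 2 ^ n).toNat}) := by
        refine measure_mono fun ω ⟨p, hp⟩ => ?_
        simpa only [Set.mem_iUnion, exists_prop, Set.mem_ofPred_eq] using binCode_mem_of_near hp
    _ ≤ ∑ _u ∈ Finset.Icc (⌊t / 2 ^ N⌋ - 2) (⌊t / 2 ^ N⌋ + 1), 2⁻¹ ^ n :=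
        (measure_biUnion_finset_le _ _).trans
          (Finset.sum_le_sum fun _ _ => prob_binCode_eq_le N n i _)
    _ = 4 * 2⁻¹ ^ n := by
        have : (⌊t / 2 ^ N⌋ + 1 + 1 - (⌊t / 2 ^ N⌋ - 2)).toNat = 4 := by omega
        rw [Finset.sum_const, Int.card_Icc, this, nsmul_eq_mul, Nat.cast_ofNat]

theorem prob_near_le (i : Fin d) (t : ℝ) {r : ℝ} (hr : 0 < r) (j : ℤ) :
    prob d {ω | ∃ p : ℤ, |t - (2 ^ j * p + gridShift ω j i)| ≤ r} ≤
      ENNReal.ofReal (8 * (r / 2 ^ j)) := by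
  obtain ⟨N, hN, hN'⟩ := exists_mem_Ioc_zpow hr one_lt_two
  have hdouble : (2 : ℝ) ^ (N + 1) = 2 * 2 ^ N := by rw [zpow_add_one₀ two_ne_zero, mul_comm]
  rcases lt_or_ge j (N + 1) with hj | hj
  · have hjN : (2 : ℝ) ^ j ≤ 2 ^ N := zpow_le_zpow_right₀ one_le_two (by omega)
    have : 1 ≤ r / 2 ^ j := (one_le_div₀ (by positivity)).2 (hjN.trans hN.le)
    exact prob_le_one.trans (ENNReal.one_le_ofReal.2 (by linarith))
  · obtain ⟨n, rfl⟩ : ∃ n : ℕ, j = N + 1 + n := ⟨(j - (N + 1)).toNat, by omega⟩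
    calc _ ≤ prob d {ω | ∃ p : ℤ,
            |t - (2 ^ (N + 1 + n : ℤ) * p + gridShift ω (N + 1 + n) i)| ≤ 2 ^ (N + 1)} :=
          measure_mono (by rintro ω ⟨p, hp⟩; exact ⟨p, hp.trans hN'⟩)
      _ ≤ 4 * 2⁻¹ ^ n := prob_near_le_of_dyadic i t (N + 1) n
      _ = ENNReal.ofReal (4 * (2 ^ n)⁻¹) := by
          rw [ENNReal.ofReal_mul (by norm_num), ENNReal.ofReal_inv_of_pos (by positivity),
            ENNReal.ofReal_pow (by norm_num), ENNReal.inv_pow]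
          simp
      _ ≤ _ := by
          refine ENNReal.ofReal_le_ofReal ?_
          rw [zpow_add₀ two_ne_zero, zpow_natCast, ← div_div, ← div_eq_mul_inv, ← mul_div_assoc]
          gcongr
          rw [← mul_div_assoc, le_div_iff₀ (by positivity)]
          linarith

theorem prob_nearGrid_le (x : ℝ^d) {r : ℝ} (hr : 0 < r) (j : ℤ) :
    prob d (nearGrid x r j) ≤ min 1 (ENNReal.ofReal (8 * d * (r / 2 ^ j))) := by
  refine le_min prob_le_one ?_
  calc prob d (nearGrid x r j)
      ≤ ∑ i, prob d {ω | ∃ p : ℤ, |x i - (2 ^ j * p + gridShift ω j i)| ≤ r} := by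
        rw [nearGrid, Set.ofPred_exists]
        exact measure_iUnion_fintype_le _ _
    _ ≤ ∑ _i : Fin d, ENNReal.ofReal (8 * (r / 2 ^ j)) :=
        Finset.sum_le_sum fun i _ => prob_near_le i (x i) hr j
    _ = ENNReal.ofReal (8 * d * (r / 2 ^ j)) := by
        rw [Finset.sum_const, Finset.card_univ, Fintype.card_fin, nsmul_eq_mul,
          mul_comm 8 (d : ℝ), mul_assoc, ENNReal.ofReal_mul (Nat.cast_nonneg d),
          ENNReal.ofReal_natCast]

/-- The position of the cube of side length `2^k` that contains `x`. -/
def cubeIdx (ω : Omega d) (k : ℤ) (x : ℝ^d) : Fin d → ℤ :=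
  fun i => ⌊(x i - gridShift ω k i) / 2 ^ k⌋

theorem mem_toSet_iff (ω : Omega d) (Q : Cube d) (x : ℝ^d) :
    x ∈ Q.toSet ω ↔ cubeIdx ω Q.scale x = Q.pos := by
  have hpos : (0 : ℝ) < 2 ^ Q.scale := by positivity
  rw [funext_iff]
  refine forall_congr' fun i => ?_
  rw [cubeIdx, Int.floor_eq_iff, le_div_iff₀ hpos, div_lt_iff₀ hpos, Cube.side]
  constructor <;> rintro ⟨h, h'⟩ <;> constructor <;> linarith

theorem mem_toSet_cubeIdx (ω : Omega d) (k : ℤ) (x : ℝ^d) (i : Fin d) :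
    2 ^ k * (cubeIdx ω k x i : ℝ) + gridShift ω k i ≤ x i ∧
      x i < 2 ^ k * ((cubeIdx ω k x i : ℝ) + 1) + gridShift ω k i :=
  (mem_toSet_iff ω ⟨k, cubeIdx ω k x⟩ x).2 rfl i

theorem cubeIdx_add (ω : Omega d) (k : ℤ) (n : ℕ) (x : ℝ^d) (i : Fin d) :
    cubeIdx ω (k + n) x i = (cubeIdx ω k x i - binCode ω k n i) / 2 ^ n := by
  have : (x i - gridShift ω (k + n) i) / 2 ^ (k + n : ℤ) =
      ((x i - gridShift ω k i) / 2 ^ k - (binCode ω k n i : ℕ)) / ((2 ^ n : ℕ) : ℝ) := by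
    rw [gridShift_add, zpow_add₀ two_ne_zero, zpow_natCast]
    field_simp
    push_cast
    ring
  rw [cubeIdx, this, Int.floor_div_natCast, Int.floor_sub_natCast]
  simp [cubeIdx]

theorem cubeIdx_eq_of_le {ω : Omega d} {j k : ℤ} (hjk : j ≤ k) {x x' : ℝ^d}
    (h : cubeIdx ω j x = cubeIdx ω j x') : cubeIdx ω k x = cubeIdx ω k x' := by
  obtain ⟨n, rfl⟩ : ∃ n : ℕ, k = j + n := ⟨(k - j).toNat, by omega⟩
  funext i
  rw [cubeIdx_add, cubeIdx_add, h]

theorem mem_nearGrid_of_cubeIdx_lt {ω : Omega d} {j : ℤ} {x x' z : ℝ^d} {r : ℝ} {i : Fin d}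
    (h : cubeIdx ω j x i < cubeIdx ω j x' i) (hxx' : |x i - x' i| ≤ r) (hz : z = x ∨ z = x') :
    ω ∈ nearGrid z r j := by
  refine ⟨i, cubeIdx ω j x' i, ?_⟩
  have hx := (mem_toSet_cubeIdx ω j x i).2
  have hx' := (mem_toSet_cubeIdx ω j x' i).1
  have hlt : (2 : ℝ) ^ j * ((cubeIdx ω j x i : ℝ) + 1) ≤ 2 ^ j * cubeIdx ω j x' i := by
    gcongr
    exact_mod_cast h
  rw [abs_le] at hxx' ⊢
  rcases hz with rfl | rfl <;> constructor <;> linarith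

theorem cubeIdx_eq_of_notMem_nearGrid {ω : Omega d} {x x' : ℝ^d} {r : ℝ} {j : ℤ}
    (hω : ω ∉ nearGrid x r j) (hxx' : ‖x - x'‖ ≤ r) : cubeIdx ω j x = cubeIdx ω j x' := by
  by_contra hne
  obtain ⟨i, hi⟩ := Function.ne_iff.1 hne
  have hxi : |x i - x' i| ≤ r := (PiLp.norm_apply_le (x - x') i).trans hxx'
  rcases lt_or_gt_of_ne hi with h | h
  · exact hω (mem_nearGrid_of_cubeIdx_lt h hxi (.inl rfl))
  · exact hω (mem_nearGrid_of_cubeIdx_lt h (abs_sub_comm (x i) _ ▸ hxi) (.inr rfl))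

theorem norm_sub_le_of_cubeIdx_eq {ω : Omega d} {k : ℤ} {x y : ℝ^d}
    (h : cubeIdx ω k x = cubeIdx ω k y) : ‖x - y‖ ≤ d * 2 ^ k := by
  have hi (i : Fin d) : ‖(x - y) i‖ ≤ 2 ^ k := by
    have hx := mem_toSet_cubeIdx ω k x i
    have hy := mem_toSet_cubeIdx ω k y i
    rw [h] at hx
    rw [Real.norm_eq_abs, PiLp.sub_apply, abs_le]
    constructor <;> linarith
  calc ‖x - y‖ = ‖∑ i, EuclideanSpace.single i ((x - y) i)‖ := by
        congr 1
        ext j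
        simp
    _ ≤ ∑ i, ‖EuclideanSpace.single i ((x - y) i)‖ := norm_sum_le _ _
    _ ≤ ∑ _i : Fin d, (2 : ℝ) ^ k := by
        simp only [PiLp.norm_single]
        exact Finset.sum_le_sum fun i _ => hi i
    _ = d * 2 ^ k := by simp

theorem measurable_cubeIdx (ω : Omega d) (k : ℤ) : Measurable (cubeIdx ω k) :=
  measurable_pi_lambda _ fun i => Int.measurable_floor.comp (by fun_prop)

theorem measurableSet_toSet (ω : Omega d) (Q : Cube d) : MeasurableSet (Q.toSet ω) := by
  have : Q.toSet ω = cubeIdx ω Q.scale ⁻¹' {Q.pos} := Set.ext (mem_toSet_iff ω Q)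
  rw [this]
  exact measurable_cubeIdx ω _ (measurableSet_singleton _)

theorem mem_descendants {ω : Omega d} {m : ℕ} {Q R : Cube d} :
    R ∈ descendants ω m Q ↔ R.scale = Q.scale - m ∧ R.toSet ω ⊆ Q.toSet ω :=
  Set.Finite.mem_toFinset _

namespace IsHaarFunction

variable {ω : Omega d} {Q : Cube d} {h : ℝ^d → ℝ}

theorem eq_zero (hh : IsHaarFunction ω Q h) {x : ℝ^d} (hx : x ∉ Q.toSet ω) : h x = 0 := by
  obtain ⟨c, hc⟩ := hh
  rw [hc]
  refine Finset.sum_eq_zero fun R hR => ?_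
  rw [Set.indicator_of_notMem fun hxR => hx ((mem_descendants.1 hR).2 hxR), mul_zero]

theorem eq_zero_of_cubeIdx_ne (hh : IsHaarFunction ω Q h) {x : ℝ^d}
    (hx : cubeIdx ω Q.scale x ≠ Q.pos) : h x = 0 :=
  hh.eq_zero fun hxQ => hx ((mem_toSet_iff ω Q x).1 hxQ)

theorem eq_of_cubeIdx_eq (hh : IsHaarFunction ω Q h) {x x' : ℝ^d}
    (hx : cubeIdx ω (Q.scale - 1) x = cubeIdx ω (Q.scale - 1) x') : h x = h x' := by
  classical
  obtain ⟨c, hc⟩ := hh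
  rw [hc, hc]
  refine Finset.sum_congr rfl fun R hR => ?_
  have hscale : R.scale = Q.scale - 1 := by simpa using (mem_descendants.1 hR).1
  have : x ∈ R.toSet ω ↔ x' ∈ R.toSet ω := by
    rw [mem_toSet_iff, mem_toSet_iff, hscale, hx]
  simp only [Set.indicator_apply, this, Pi.one_apply]

theorem measurable (hh : IsHaarFunction ω Q h) : Measurable h := by
  obtain ⟨c, hc⟩ := hh
  rw [funext hc]
  exact Finset.measurable_fun_sum _ fun R _ =>
    (measurable_one.indicator (measurableSet_toSet ω R)).const_mul _

theorem exists_bound (hh : IsHaarFunction ω Q h) : ∃ B, ∀ x, ‖h x‖ ≤ B := by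
  classical
  obtain ⟨c, hc⟩ := hh
  refine ⟨∑ R ∈ descendants ω 1 Q, |c R|, fun x => ?_⟩
  rw [hc]
  refine (norm_sum_le _ _).trans (Finset.sum_le_sum fun R _ => ?_)
  rw [norm_mul, Real.norm_eq_abs]
  refine mul_le_of_le_one_right (abs_nonneg _) ?_
  rw [Set.indicator_apply]
  split_ifs <;> simp

end IsHaarFunction

theorem abs_sum_le_of_eq_zero {ι : Type*} {s : Finset ι} {u : ι → ℝ} {c : ℝ} (hc : 0 ≤ c) (a : ι)
    (hne : ∀ b ∈ s, b ≠ a → u b = 0) (ha : a ∈ s → |u a| ≤ c) : |∑ b ∈ s, u b| ≤ c := by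
  by_cases h : a ∈ s
  · rw [Finset.sum_eq_single_of_mem a h hne]
    exact ha h
  · rwa [Finset.sum_eq_zero fun b hb => hne b hb fun e => h (e ▸ hb), abs_zero]

theorem measurable_comp_countable {ι α β : Type*} [Countable ι] [MeasurableSpace ι]
    [MeasurableSingletonClass ι] [MeasurableSpace α] [MeasurableSpace β] {F : ι → α → β}
    (hF : ∀ i, Measurable (F i)) {e : α → ι} (he : Measurable e) :
    Measurable fun z => F (e z) z :=
  (measurable_from_prod_countable_right (f := fun q : ι × α => F q.1 q.2) hF).comp
    (he.prodMk measurable_id)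

/-- The families `h^{Q'}_{Q''}` and `h^{Q''}_{Q'}` of Haar functions of a Haar shift of complexity
type `(m, n)`, called `hin Q' Q''` and `hout Q' Q''` as in `IsHaarShift`. -/
def IsShiftData (ω : Omega d) (m n : ℕ) (hin hout : Cube d → Cube d → ℝ^d → ℝ) : Prop :=
  ∀ Q : Cube d, ∀ Q' ∈ descendants ω m Q, ∀ Q'' ∈ descendants ω n Q,
    IsHaarFunction ω Q'' (hin Q' Q'') ∧ IsHaarFunction ω Q' (hout Q' Q'') ∧
    ∀ x y, |hin Q' Q'' y * hout Q' Q'' x| ≤ 1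

/-- The integral kernel of `scalePart`. For given `x`, only the cube `Q` of side length `2^k` that
contains `x` contributes. -/
def scaleKernel (ω : Omega d) (m n : ℕ) (hin hout : Cube d → Cube d → ℝ^d → ℝ) (k : ℤ)
    (x y : ℝ^d) : ℝ :=
  (1 / ((2 : ℝ) ^ k) ^ d) *
    ∑ Q' ∈ descendants ω m ⟨k, cubeIdx ω k x⟩, ∑ Q'' ∈ descendants ω n ⟨k, cubeIdx ω k x⟩,
      hin Q' Q'' y * hout Q' Q'' x

/-- A bound for the kernel of a Haar shift at scale `2^k` at two points at distance `ρ`: it is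
`2^{-kd}` unless the points are too far apart to lie in a common cube of side length `2^k`. -/
def cutoff (d : ℕ) (ρ : ℝ) (k : ℤ) : ℝ := if ρ ≤ d * 2 ^ k then 1 / ((2 : ℝ) ^ k) ^ d else 0

theorem cutoff_nonneg (ρ : ℝ) (k : ℤ) : 0 ≤ cutoff d ρ k := by
  unfold cutoff
  positivity

theorem cutoff_le (ρ : ℝ) (k : ℤ) : cutoff d ρ k ≤ 1 / ((2 : ℝ) ^ k) ^ d := by
  unfold cutoff
  split_ifs
  · exact le_rfl
  · positivity

theorem cutoff_anti {ρ ρ' : ℝ} (h : ρ ≤ ρ') (k : ℤ) : cutoff d ρ' k ≤ cutoff d ρ k := by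
  unfold cutoff
  split_ifs with h₁ h₂
  · exact le_rfl
  · exact absurd (h.trans h₁) h₂
  · positivity
  · exact le_rfl

namespace IsShiftData

variable {ω : Omega d} {m n : ℕ} {hin hout : Cube d → Cube d → ℝ^d → ℝ}

theorem scaleKernel_eq_zero (H : IsShiftData ω m n hin hout) {k : ℤ} {x y : ℝ^d}
    (hxy : cubeIdx ω k x ≠ cubeIdx ω k y) : scaleKernel ω m n hin hout k x y = 0 := by
  rw [scaleKernel, Finset.sum_eq_zero, mul_zero]
  refine fun Q' hQ' => Finset.sum_eq_zero fun Q'' hQ'' => ?_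
  rw [(H _ _ hQ' Q'' hQ'').1.eq_zero, zero_mul]
  exact fun hy => hxy ((mem_toSet_iff _ _ _).1 ((mem_descendants.1 hQ'').2 hy)).symm

theorem abs_sum_le_one (H : IsShiftData ω m n hin hout) (Q : Cube d) (x y : ℝ^d) :
    |∑ Q' ∈ descendants ω m Q, ∑ Q'' ∈ descendants ω n Q, hin Q' Q'' y * hout Q' Q'' x| ≤ 1 := by
  refine abs_sum_le_of_eq_zero zero_le_one ⟨Q.scale - m, cubeIdx ω (Q.scale - m) x⟩
    (fun Q' hQ' hne => Finset.sum_eq_zero fun Q'' hQ'' => ?_) fun hQ' => ?_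
  · rw [(H _ Q' hQ' Q'' hQ'').2.1.eq_zero_of_cubeIdx_ne, mul_zero]
    have hscale := (mem_descendants.1 hQ').1
    exact fun hx => hne (Cube.ext hscale (hscale ▸ hx.symm))
  refine abs_sum_le_of_eq_zero zero_le_one ⟨Q.scale - n, cubeIdx ω (Q.scale - n) y⟩
    (fun Q'' hQ'' hne => ?_) fun hQ'' => (H _ _ hQ' _ hQ'').2.2 x y
  rw [(H _ _ hQ' Q'' hQ'').1.eq_zero_of_cubeIdx_ne, zero_mul]
  have hscale := (mem_descendants.1 hQ'').1
  exact fun hy => hne (Cube.ext hscale (hscale ▸ hy.symm))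

theorem abs_scaleKernel_le (H : IsShiftData ω m n hin hout) (k : ℤ) (x y : ℝ^d) :
    |scaleKernel ω m n hin hout k x y| ≤ cutoff d ‖x - y‖ k := by
  by_cases hxy : cubeIdx ω k x = cubeIdx ω k y
  · rw [cutoff, if_pos (norm_sub_le_of_cubeIdx_eq hxy), scaleKernel, abs_mul,
      abs_of_nonneg (by positivity)]
    exact mul_le_of_le_one_right (by positivity) (H.abs_sum_le_one _ x y)
  · rw [H.scaleKernel_eq_zero hxy, abs_zero]
    exact cutoff_nonneg _ _

theorem scaleKernel_eq_left (H : IsShiftData ω m n hin hout) {k : ℤ} {x x' : ℝ^d} (y : ℝ^d)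
    (h : cubeIdx ω (k - m - 1) x = cubeIdx ω (k - m - 1) x') :
    scaleKernel ω m n hin hout k x y = scaleKernel ω m n hin hout k x' y := by
  have hk : cubeIdx ω k x = cubeIdx ω k x' := cubeIdx_eq_of_le (by omega) h
  rw [scaleKernel, scaleKernel, hk]
  congr 1
  refine Finset.sum_congr rfl fun Q' hQ' => Finset.sum_congr rfl fun Q'' hQ'' => ?_
  rw [(H _ _ hQ' Q'' hQ'').2.1.eq_of_cubeIdx_eq (x := x) (x' := x')]
  rwa [(mem_descendants.1 hQ').1]

theorem scaleKernel_eq_right (H : IsShiftData ω m n hin hout) {k : ℤ} (x : ℝ^d) {y y' : ℝ^d}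
    (h : cubeIdx ω (k - n - 1) y = cubeIdx ω (k - n - 1) y') :
    scaleKernel ω m n hin hout k x y = scaleKernel ω m n hin hout k x y' := by
  rw [scaleKernel, scaleKernel]
  congr 1
  refine Finset.sum_congr rfl fun Q' hQ' => Finset.sum_congr rfl fun Q'' hQ'' => ?_
  rw [(H _ _ hQ' Q'' hQ'').1.eq_of_cubeIdx_eq (x := y) (x' := y')]
  rwa [(mem_descendants.1 hQ'').1]

theorem measurable_scaleKernel (H : IsShiftData ω m n hin hout) (k : ℤ) :
    Measurable fun z : ℝ^d × ℝ^d => scaleKernel ω m n hin hout k z.1 z.2 := by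
  have hfixed (p : Fin d → ℤ) : Measurable fun z : ℝ^d × ℝ^d => (1 / ((2 : ℝ) ^ k) ^ d) *
      ∑ Q' ∈ descendants ω m ⟨k, p⟩, ∑ Q'' ∈ descendants ω n ⟨k, p⟩,
        hin Q' Q'' z.2 * hout Q' Q'' z.1 := by
    refine Measurable.const_mul (Finset.measurable_fun_sum _ fun Q' hQ' =>
      Finset.measurable_fun_sum _ fun Q'' hQ'' => ?_) _
    exact ((H _ _ hQ' Q'' hQ'').1.measurable.comp measurable_snd).mul
      ((H _ _ hQ' Q'' hQ'').2.1.measurable.comp measurable_fst)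
  exact measurable_comp_countable hfixed ((measurable_cubeIdx ω k).comp measurable_fst)

theorem integral_mul_scaleKernel (H : IsShiftData ω m n hin hout) (k : ℤ) {f : ℝ^d → ℝ}
    (hf : Integrable f) (x : ℝ^d) :
    ∫ y, f y * scaleKernel ω m n hin hout k x y = (1 / ((2 : ℝ) ^ k) ^ d) *
      ∑ Q' ∈ descendants ω m ⟨k, cubeIdx ω k x⟩, ∑ Q'' ∈ descendants ω n ⟨k, cubeIdx ω k x⟩,
        (∫ y, f y * hin Q' Q'' y) * hout Q' Q'' x := by
  have hint : ∀ Q' ∈ descendants ω m ⟨k, cubeIdx ω k x⟩,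
      ∀ Q'' ∈ descendants ω n ⟨k, cubeIdx ω k x⟩,
      Integrable fun y => f y * hin Q' Q'' y * hout Q' Q'' x := by
    intro Q' hQ' Q'' hQ''
    obtain ⟨B, hB⟩ := (H _ _ hQ' Q'' hQ'').1.exists_bound
    exact (hf.mul_bdd (c := B) (H _ _ hQ' Q'' hQ'').1.measurable.aestronglyMeasurable
      (Eventually.of_forall hB)).mul_const _
  have hdistrib (y : ℝ^d) : f y * scaleKernel ω m n hin hout k x y = (1 / ((2 : ℝ) ^ k) ^ d) *
      ∑ Q' ∈ descendants ω m ⟨k, cubeIdx ω k x⟩, ∑ Q'' ∈ descendants ω n ⟨k, cubeIdx ω k x⟩,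
        f y * hin Q' Q'' y * hout Q' Q'' x := by
    simp only [scaleKernel, mul_left_comm (f y), mul_assoc (f y), Finset.mul_sum]
  simp only [hdistrib]
  rw [integral_const_mul, integral_finsetSum _ fun Q' hQ' =>
    integrable_finsetSum _ fun Q'' hQ'' => hint Q' hQ' Q'' hQ'']
  congr 1
  refine Finset.sum_congr rfl fun Q' hQ' => ?_
  rw [integral_finsetSum _ fun Q'' hQ'' => hint Q' hQ' Q'' hQ'']
  simp only [integral_mul_const]

theorem scalePart_eq_integral (H : IsShiftData ω m n hin hout) (k : ℤ) {f : ℝ^d → ℝ}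
    (hf : Integrable f) (x : ℝ^d) :
    scalePart ω m n hin hout k f x = ∫ y, f y * scaleKernel ω m n hin hout k x y := by
  rw [scalePart, H.integral_mul_scaleKernel k hf, tsum_eq_single (cubeIdx ω k x), Cube.side]
  intro p hp
  rw [Finset.sum_eq_zero, mul_zero]
  refine fun Q' hQ' => Finset.sum_eq_zero fun Q'' hQ'' => ?_
  rw [(H _ _ hQ' Q'' hQ'').2.1.eq_zero, mul_zero]
  exact fun hx => hp ((mem_toSet_iff _ _ _).1 ((mem_descendants.1 hQ').2 hx)).symm

theorem integrable_mul_scaleKernel (H : IsShiftData ω m n hin hout) (k : ℤ) {w : ℝ^d × ℝ^d → ℝ}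
    (hw : Integrable w (volume.prod volume)) :
    Integrable (fun z => w z * scaleKernel ω m n hin hout k z.1 z.2) (volume.prod volume) :=
  hw.mul_bdd (c := 1 / ((2 : ℝ) ^ k) ^ d) (H.measurable_scaleKernel k).aestronglyMeasurable
    (Eventually.of_forall fun z => (H.abs_scaleKernel_le k z.1 z.2).trans (cutoff_le _ k))

theorem hasIntegral_scalePart_mul (H : IsShiftData ω m n hin hout) (k : ℤ)
    {f g : ℝ^d → ℝ} (hf : Integrable f) (hg : Integrable g) :
    Integrable (fun x => scalePart ω m n hin hout k f x * g x) ∧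
    ∫ x, scalePart ω m n hin hout k f x * g x =
      ∫ z : ℝ^d × ℝ^d, f z.2 * g z.1 * scaleKernel ω m n hin hout k z.1 z.2
        ∂(volume.prod volume) := by
  have hfg : Integrable (fun z : ℝ^d × ℝ^d => f z.2 * g z.1) (volume.prod volume) := by
    simpa only [mul_comm] using hg.mul_prod hf
  have hint := H.integrable_mul_scaleKernel k hfg
  have heq (x : ℝ^d) : scalePart ω m n hin hout k f x * g x =
      ∫ y, f y * g x * scaleKernel ω m n hin hout k x y := by
    rw [H.scalePart_eq_integral k hf, ← integral_mul_const]
    simp only [mul_right_comm]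
  simp only [heq]
  exact ⟨hint.integral_prod_left, (integral_prod _ hint).symm⟩

end IsShiftData

theorem scalePart_congr_ae (ω : Omega d) (m n : ℕ) (hin hout : Cube d → Cube d → ℝ^d → ℝ) (k : ℤ)
    {f f' : ℝ^d → ℝ} (h : f =ᵐ[volume] f') :
    scalePart ω m n hin hout k f = scalePart ω m n hin hout k f' := by
  have hint (Q' Q'' : Cube d) : ∫ y, f y * hin Q' Q'' y = ∫ y, f' y * hin Q' Q'' y :=
    integral_congr_ae <| h.mono fun y hy => congrArg (· * hin Q' Q'' y) hy
  funext x
  simp only [scalePart, hint]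

/-- The sum of the geometric series with ratio `2^{-a}`. -/
def geomConst (a : ℝ) : ℝ≥0∞ := ∑' l : ℕ, ENNReal.ofReal ((2 : ℝ) ^ (-((l : ℝ) * a)))

theorem summable_two_rpow {a : ℝ} (ha : 0 < a) :
    Summable fun l : ℕ => (2 : ℝ) ^ (-((l : ℝ) * a)) := by
  have hpow (l : ℕ) : (2 : ℝ) ^ (-((l : ℝ) * a)) = ((2 : ℝ) ^ (-a)) ^ l := by
    rw [← Real.rpow_mul_natCast zero_le_two, neg_mul, mul_comm]
  simp only [hpow]
  exact summable_geometric_of_lt_one (by positivity)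
    (Real.rpow_lt_one_of_one_lt_of_neg one_lt_two (neg_lt_zero.2 ha))

theorem geomConst_ne_top {a : ℝ} (ha : 0 < a) : geomConst a ≠ ∞ :=
  (summable_two_rpow ha).tsum_ofReal_ne_top

/-- The sum of `min 1 u * u^{-δ}` over all integral powers `u` of `2`. -/
def crossConst (δ : ℝ) : ℝ≥0∞ :=
  ∑' l : ℤ, ENNReal.ofReal (min 1 ((2 : ℝ) ^ l) * (2 : ℝ) ^ (-((l : ℝ) * δ)))

theorem crossConst_ne_top {δ : ℝ} (hδ0 : 0 < δ) (hδ1 : δ < 1) : crossConst δ ≠ ∞ := by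
  refine Summable.tsum_ofReal_ne_top (Summable.of_nat_of_neg ?_ ?_)
  · refine .of_nonneg_of_le (fun l => by positivity) (fun l => ?_) (summable_two_rpow hδ0)
    rw [Int.cast_natCast]
    exact mul_le_of_le_one_left (by positivity) (min_le_left _ _)
  · refine .of_nonneg_of_le (fun l => by positivity) (fun l => ?_)
      (summable_two_rpow (sub_pos.2 hδ1))
    calc _ ≤ (2 : ℝ) ^ (-(l : ℤ)) * (2 : ℝ) ^ (-(((-(l : ℤ) : ℤ) : ℝ) * δ)) := by
          gcongr
          exact min_le_right _ _
      _ = _ := by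
          rw [← Real.rpow_intCast, ← Real.rpow_add two_pos]
          push_cast
          ring_nf

theorem tsum_le_two_zpow_le {a u : ℝ} (ha : 0 ≤ a) (hu : 0 < u) :
    ∑' k : ℤ, (if u ≤ 2 ^ k then ENNReal.ofReal ((2 : ℝ) ^ (-((k : ℝ) * a))) else 0) ≤
      ENNReal.ofReal (u ^ (-a)) * geomConst a := by
  obtain ⟨k₀, hk₀, hk₀'⟩ := exists_mem_Ioc_zpow hu one_lt_two
  have hinj : Function.Injective fun l : ℕ => k₀ + 1 + (l : ℤ) := fun b c hbc => by simpa using hbc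
  rw [← hinj.tsum_eq, geomConst, ← ENNReal.tsum_mul_left]
  · refine ENNReal.tsum_le_tsum fun l => ?_
    split_ifs
    · rw [← ENNReal.ofReal_mul (by positivity)]
      refine ENNReal.ofReal_le_ofReal ?_
      calc (2 : ℝ) ^ (-(((k₀ + 1 + l : ℤ) : ℝ) * a))
          = ((2 : ℝ) ^ (k₀ + 1)) ^ (-a) * (2 : ℝ) ^ (-((l : ℝ) * a)) := by
            rw [← Real.rpow_intCast, ← Real.rpow_mul zero_le_two, ← Real.rpow_add two_pos]
            push_cast
            ring_nf
        _ ≤ u ^ (-a) * (2 : ℝ) ^ (-((l : ℝ) * a)) := by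
            gcongr ?_ * _
            exact Real.rpow_le_rpow_of_nonpos hu hk₀' (neg_nonpos.2 ha)
    · exact zero_le
  · intro k hk
    have hle : u ≤ 2 ^ k := by_contra fun hcon => hk (if_neg hcon)
    have hlt : k₀ < k := (zpow_lt_zpow_iff_right₀ one_lt_two).1 (hk₀.trans_le hle)
    exact ⟨(k - (k₀ + 1)).toNat, by dsimp only; omega⟩

theorem tsum_mul_min_two_zpow_le (δ : ℝ) (a : ℤ) :
    ∑' m : ℕ, ENNReal.ofReal ((2 : ℝ) ^ (-((m : ℝ) * δ)) * min 1 ((2 : ℝ) ^ (a + m))) ≤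
      ENNReal.ofReal ((2 : ℝ) ^ ((a : ℝ) * δ)) * crossConst δ := by
  have hshift (m : ℕ) : (2 : ℝ) ^ (-((m : ℝ) * δ)) * min 1 ((2 : ℝ) ^ (a + m)) =
      (2 : ℝ) ^ ((a : ℝ) * δ) *
        (min 1 ((2 : ℝ) ^ (a + m)) * (2 : ℝ) ^ (-(((a + m : ℤ) : ℝ) * δ))) := by
    rw [mul_left_comm, ← Real.rpow_add two_pos, mul_comm]
    push_cast
    ring_nf
  simp only [hshift, ENNReal.ofReal_mul (show (0 : ℝ) ≤ (2 : ℝ) ^ ((a : ℝ) * δ) by positivity)]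
  rw [ENNReal.tsum_mul_left]
  gcongr
  exact ENNReal.tsum_comp_le_tsum_of_injective (f := fun m : ℕ => a + (m : ℤ))
    (fun b c hbc => by simpa using hbc)
    (fun l : ℤ => ENNReal.ofReal (min 1 ((2 : ℝ) ^ l) * (2 : ℝ) ^ (-((l : ℝ) * δ))))

theorem tsum_mul_min_le {δ u : ℝ} (hδ : 0 ≤ δ) (hu : 0 < u) :
    ∑' m : ℕ, ENNReal.ofReal ((2 : ℝ) ^ (-((m : ℝ) * δ)) * min 1 (u * 2 ^ m)) ≤
      ENNReal.ofReal ((2 * u) ^ δ) * crossConst δ := by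
  obtain ⟨a, ha, ha'⟩ := exists_mem_Ioc_zpow hu one_lt_two
  calc _ ≤ ∑' m : ℕ, ENNReal.ofReal
          ((2 : ℝ) ^ (-((m : ℝ) * δ)) * min 1 ((2 : ℝ) ^ (a + 1 + m : ℤ))) := by
        gcongr with m
        rw [zpow_add₀ two_ne_zero, zpow_natCast]
        gcongr
    _ ≤ ENNReal.ofReal ((2 : ℝ) ^ (((a + 1 : ℤ) : ℝ) * δ)) * crossConst δ :=
        tsum_mul_min_two_zpow_le δ _
    _ ≤ ENNReal.ofReal ((2 * u) ^ δ) * crossConst δ := by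
        rw [Real.rpow_mul zero_le_two, Real.rpow_intCast, zpow_add_one₀ two_ne_zero, mul_comm _ 2]
        gcongr

theorem tsum_cutoff_le (hd : 1 ≤ d) {b : ℝ} (hb : 0 ≤ b) {ρ : ℝ} (hρ : 0 < ρ) :
    ∑' k : ℤ, ENNReal.ofReal (cutoff d ρ k * (2 : ℝ) ^ (-((k : ℝ) * b))) ≤
      ENNReal.ofReal ((d / ρ) ^ (b + d)) * geomConst (b + d) := by
  have hd0 : (0 : ℝ) < d := by exact_mod_cast hd
  have hterm (k : ℤ) : ENNReal.ofReal (cutoff d ρ k * (2 : ℝ) ^ (-((k : ℝ) * b))) =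
      if ρ / d ≤ 2 ^ k then ENNReal.ofReal ((2 : ℝ) ^ (-((k : ℝ) * (b + d)))) else 0 := by
    simp only [cutoff, div_le_iff₀' hd0]
    split_ifs
    · rw [one_div, ← Real.rpow_intCast, ← Real.rpow_natCast, ← Real.rpow_mul zero_le_two,
        ← Real.rpow_neg zero_le_two, ← Real.rpow_add two_pos]
      ring_nf
    · rw [zero_mul, ENNReal.ofReal_zero]
  simp only [hterm]
  refine (tsum_le_two_zpow_le (by positivity) (div_pos hρ hd0)).trans_eq ?_
  rw [Real.rpow_neg (by positivity), ← Real.inv_rpow (by positivity), inv_div]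

/-- The assumed bound `2^{-(m+n)δ}` for the coefficient of a Haar shift of complexity type
`(m, n)`. -/
def weight (δ : ℝ) (p : ℕ × ℕ) : ℝ := (2 : ℝ) ^ (-(((p.1 : ℝ) + p.2) * δ))

theorem weight_pos (δ : ℝ) (p : ℕ × ℕ) : 0 < weight δ p := by
  unfold weight
  positivity

theorem weight_eq (δ : ℝ) (m n : ℕ) :
    weight δ (m, n) = (2 : ℝ) ^ (-((m : ℝ) * δ)) * (2 : ℝ) ^ (-((n : ℝ) * δ)) := by
  rw [weight, ← Real.rpow_add two_pos]
  ring_nf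

theorem tsum_weight (δ : ℝ) :
    ∑' p : ℕ × ℕ, ENNReal.ofReal (weight δ p) = geomConst δ * geomConst δ := by
  have hmul (m n : ℕ) : ENNReal.ofReal (weight δ (m, n)) =
      ENNReal.ofReal ((2 : ℝ) ^ (-((m : ℝ) * δ))) *
        ENNReal.ofReal ((2 : ℝ) ^ (-((n : ℝ) * δ))) := by
    rw [weight_eq, ENNReal.ofReal_mul (by positivity)]
  simp only [ENNReal.tsum_prod', hmul, ENNReal.tsum_mul_left, ENNReal.tsum_mul_right, geomConst]

theorem summable_weight {δ : ℝ} (hδ : 0 < δ) : Summable (weight δ) := by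
  have h : ∑' p : ℕ × ℕ, ENNReal.ofReal (weight δ p) ≠ ∞ := by
    rw [tsum_weight]
    exact ENNReal.mul_ne_top (geomConst_ne_top hδ) (geomConst_ne_top hδ)
  simpa only [ENNReal.toReal_ofReal (weight_pos δ _).le] using ENNReal.summable_toReal h

/-- The constant in the size estimate for the sum of the kernels of weighted Haar shifts. -/
def sizeConst (d : ℕ) (δ : ℝ) : ℝ := (geomConst δ * geomConst δ * geomConst d).toReal * d ^ d

theorem sizeConst_nonneg (d : ℕ) (δ : ℝ) : 0 ≤ sizeConst d δ := by
  unfold sizeConst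
  positivity

theorem tsum_weight_mul_cutoff_le (hd : 1 ≤ d) {δ : ℝ} (hδ : 0 < δ) {ρ : ℝ} (hρ : 0 < ρ) :
    ∑' q : (ℕ × ℕ) × ℤ, ENNReal.ofReal (weight δ q.1 * cutoff d ρ q.2) ≤
      ENNReal.ofReal (sizeConst d δ / ρ ^ d) := by
  have hfin : geomConst δ * geomConst δ * geomConst d ≠ ∞ :=
    ENNReal.mul_ne_top (ENNReal.mul_ne_top (geomConst_ne_top hδ) (geomConst_ne_top hδ))
      (geomConst_ne_top (by exact_mod_cast hd))
  have hcutoff := tsum_cutoff_le hd le_rfl hρ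
  simp only [mul_zero, neg_zero, Real.rpow_zero, mul_one, zero_add, Real.rpow_natCast] at hcutoff
  calc _ = geomConst δ * geomConst δ * ∑' k : ℤ, ENNReal.ofReal (cutoff d ρ k) := by
        simp only [ENNReal.tsum_prod' (α := ℕ × ℕ), ENNReal.ofReal_mul (weight_pos δ _).le,
          ENNReal.tsum_mul_left, ENNReal.tsum_mul_right, tsum_weight]
    _ ≤ geomConst δ * geomConst δ * (ENNReal.ofReal ((d / ρ) ^ d) * geomConst d) := by gcongr
    _ = ENNReal.ofReal (sizeConst d δ / ρ ^ d) := by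
        rw [sizeConst, mul_div_assoc, ← div_pow, ENNReal.ofReal_mul ENNReal.toReal_nonneg,
          ENNReal.ofReal_toReal hfin]
        ring

theorem summable_weight_mul_cutoff (hd : 1 ≤ d) {δ : ℝ} (hδ : 0 < δ) {ρ : ℝ} (hρ : 0 < ρ) :
    Summable fun q : (ℕ × ℕ) × ℤ => weight δ q.1 * cutoff d ρ q.2 := by
  have h := ne_top_of_le_ne_top ENNReal.ofReal_ne_top (tsum_weight_mul_cutoff_le hd hδ hρ)
  simpa only [ENNReal.toReal_ofReal (mul_nonneg (weight_pos δ _).le (cutoff_nonneg ρ _))] using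
    ENNReal.summable_toReal h

/-- The constant in the bound for the expected oscillation of the sum of the kernels of weighted
Haar shifts. The factor `32 d` combines the factor `8 d` of `prob_nearGrid_le` with two factors
`2`: one comes from the passage to the children of a cube, one from `tsum_mul_min_le`. -/
def smoothConst (d : ℕ) (δ : ℝ) : ℝ :=
  2 * (geomConst δ * crossConst δ * geomConst (δ + d)).toReal * (32 * d) ^ δ * d ^ (δ + d)

theorem smoothConst_nonneg (d : ℕ) (δ : ℝ) : 0 ≤ smoothConst d δ := by
  unfold smoothConst
  positivity

theorem tsum_weight_mul_min_le (hd : 1 ≤ d) {δ : ℝ} (hδ : 0 < δ) {r : ℝ} (hr : 0 < r) (k : ℤ) :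
    ∑' p : ℕ × ℕ, ENNReal.ofReal
        (weight δ p * min 1 (8 * d * (r / (2 : ℝ) ^ (k - p.1 - 1 : ℤ)))) ≤
      geomConst δ * crossConst δ *
        (ENNReal.ofReal ((32 * d * r) ^ δ) * ENNReal.ofReal ((2 : ℝ) ^ (-((k : ℝ) * δ)))) := by
  have hterm (m n : ℕ) : ENNReal.ofReal
      (weight δ (m, n) * min 1 (8 * d * (r / (2 : ℝ) ^ (k - m - 1 : ℤ)))) =
      ENNReal.ofReal ((2 : ℝ) ^ (-((m : ℝ) * δ)) * min 1 (16 * d * r / (2 : ℝ) ^ k * 2 ^ m)) *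
        ENNReal.ofReal ((2 : ℝ) ^ (-((n : ℝ) * δ))) := by
    rw [← ENNReal.ofReal_mul (by positivity), weight_eq, zpow_sub₀ two_ne_zero,
      zpow_sub₀ two_ne_zero, zpow_natCast, zpow_one, mul_right_comm]
    congr 4
    field_simp
    ring
  have hscale : (2 * (16 * d * r / (2 : ℝ) ^ k)) ^ δ =
      (32 * d * r) ^ δ * (2 : ℝ) ^ (-((k : ℝ) * δ)) := by
    rw [Real.rpow_neg zero_le_two, Real.rpow_mul zero_le_two, Real.rpow_intCast, ← div_eq_mul_inv,
      ← Real.div_rpow (by positivity) (by positivity)]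
    ring_nf
  have : 0 < d := hd
  simp only [ENNReal.tsum_prod', hterm, ENNReal.tsum_mul_left, ENNReal.tsum_mul_right]
  calc _ ≤ ENNReal.ofReal ((2 * (16 * d * r / (2 : ℝ) ^ k)) ^ δ) * crossConst δ * geomConst δ := by
        gcongr
        · exact tsum_mul_min_le hδ.le (by positivity)
        · exact le_rfl
    _ = _ := by
        rw [hscale, ENNReal.ofReal_mul (by positivity)]
        ring

theorem tsum_weight_mul_cutoff_mul_min_le (hd : 1 ≤ d) {δ : ℝ} (hδ0 : 0 < δ) (hδ1 : δ < 1)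
    {r ρ : ℝ} (hr : 0 < r) (hρ : 0 < ρ) :
    ∑' q : (ℕ × ℕ) × ℤ, ENNReal.ofReal (2 * (weight δ q.1 * cutoff d ρ q.2)) *
        min 1 (ENNReal.ofReal (8 * d * (r / (2 : ℝ) ^ (q.2 - q.1.1 - 1 : ℤ)))) ≤
      ENNReal.ofReal (smoothConst d δ * r ^ δ / ρ ^ (δ + d)) := by
  have hfin : geomConst δ * crossConst δ * geomConst (δ + d) ≠ ∞ :=
    ENNReal.mul_ne_top (ENNReal.mul_ne_top (geomConst_ne_top hδ0) (crossConst_ne_top hδ0 hδ1))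
      (geomConst_ne_top (by positivity))
  have hterm (p : ℕ × ℕ) (k : ℤ) : ENNReal.ofReal (2 * (weight δ p * cutoff d ρ k)) *
      min 1 (ENNReal.ofReal (8 * d * (r / (2 : ℝ) ^ (k - p.1 - 1 : ℤ)))) =
      2 * ENNReal.ofReal (cutoff d ρ k) * ENNReal.ofReal
        (weight δ p * min 1 (8 * d * (r / (2 : ℝ) ^ (k - p.1 - 1 : ℤ)))) := by
    rw [← ENNReal.ofReal_one, ← ENNReal.ofReal_mono.map_min, ENNReal.ofReal_mul two_pos.le,
      ENNReal.ofReal_mul (weight_pos δ p).le, ENNReal.ofReal_mul (weight_pos δ p).le,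
      ENNReal.ofReal_ofNat]
    ring
  rw [ENNReal.tsum_prod', ENNReal.tsum_comm]
  simp only [hterm, ENNReal.tsum_mul_left]
  calc _ ≤ ∑' k : ℤ, 2 * ENNReal.ofReal (cutoff d ρ k) * (geomConst δ * crossConst δ *
          (ENNReal.ofReal ((32 * d * r) ^ δ) * ENNReal.ofReal ((2 : ℝ) ^ (-((k : ℝ) * δ))))) := by
        gcongr with k
        exact tsum_weight_mul_min_le hd hδ0 hr k
    _ = 2 * (geomConst δ * crossConst δ) * ENNReal.ofReal ((32 * d * r) ^ δ) *
          ∑' k : ℤ, ENNReal.ofReal (cutoff d ρ k * (2 : ℝ) ^ (-((k : ℝ) * δ))) := by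
        rw [← ENNReal.tsum_mul_left]
        refine tsum_congr fun k => ?_
        rw [ENNReal.ofReal_mul (cutoff_nonneg _ _)]
        ring
    _ ≤ 2 * (geomConst δ * crossConst δ) * ENNReal.ofReal ((32 * d * r) ^ δ) *
          (ENNReal.ofReal ((d / ρ) ^ (δ + d)) * geomConst (δ + d)) := by
        gcongr
        exact tsum_cutoff_le hd hδ0.le hρ
    _ = ENNReal.ofReal (2 * (geomConst δ * crossConst δ * geomConst (δ + d)).toReal *
          (32 * d * r) ^ δ * (d / ρ) ^ (δ + d)) := by
        rw [ENNReal.ofReal_mul (by positivity), ENNReal.ofReal_mul (by positivity),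
          ENNReal.ofReal_mul zero_le_two, ENNReal.ofReal_toReal hfin, ENNReal.ofReal_ofNat]
        ring
    _ = ENNReal.ofReal (smoothConst d δ * r ^ δ / ρ ^ (δ + d)) := by
        rw [smoothConst, Real.mul_rpow (by positivity) hr.le, Real.div_rpow (by positivity) hρ.le]
        ring_nf

/-- The kernels of a weighted family of Haar shifts on `𝒟_ω`, indexed by complexity type and scale,
with the properties that enter the kernel estimates. The fields `left` and `right` say that each
kernel is constant on the children of the cubes `Q'` and `Q''`. -/
structure IsKernelFamily (δ : ℝ) (ω : Omega d) (t : (ℕ × ℕ) × ℤ → ℝ^d → ℝ^d → ℝ) : Prop where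
  bound : ∀ q x y, |t q x y| ≤ weight δ q.1 * cutoff d ‖x - y‖ q.2
  left : ∀ (q : (ℕ × ℕ) × ℤ) (x x' y : ℝ^d),
    cubeIdx ω (q.2 - q.1.1 - 1) x = cubeIdx ω (q.2 - q.1.1 - 1) x' → t q x y = t q x' y
  right : ∀ (q : (ℕ × ℕ) × ℤ) (x y y' : ℝ^d),
    cubeIdx ω (q.2 - q.1.2 - 1) y = cubeIdx ω (q.2 - q.1.2 - 1) y' → t q x y = t q x y'
  measurable : ∀ q, Measurable fun z : ℝ^d × ℝ^d => t q z.1 z.2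

/-- A majorant of the oscillation, within distance `r` of `x` and at distance at least `ρ` from the
diagonal, of the sum of a kernel family on `𝒟_ω`. A kernel of complexity type `(m, n)` and scale `k`
oscillates only if `x` is near the boundary of a cube of side length `2^{k-m-1}`. -/
def oscMajorant (δ : ℝ) (x : ℝ^d) (r ρ : ℝ) (ω : Omega d) : ℝ≥0∞ :=
  ∑' q : (ℕ × ℕ) × ℤ, (nearGrid x r (q.2 - q.1.1 - 1)).indicator
    (fun _ => ENNReal.ofReal (2 * (weight δ q.1 * cutoff d ρ q.2))) ω

theorem measurable_oscMajorant (δ : ℝ) (x : ℝ^d) (r ρ : ℝ) : Measurable (oscMajorant δ x r ρ) :=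
  Measurable.tsum fun _ => measurable_const.indicator (measurableSet_nearGrid x r _)

theorem lintegral_oscMajorant_le (hd : 1 ≤ d) {δ : ℝ} (hδ0 : 0 < δ) (hδ1 : δ < 1) (x : ℝ^d)
    {r ρ : ℝ} (hr : 0 < r) (hρ : 0 < ρ) :
    ∫⁻ ω, oscMajorant δ x r ρ ω ∂prob d ≤
      ENNReal.ofReal (smoothConst d δ * r ^ δ / ρ ^ (δ + d)) := by
  have hmeas (j : ℤ) := measurableSet_nearGrid x r j
  refine le_trans ?_ (tsum_weight_mul_cutoff_mul_min_le hd hδ0 hδ1 hr hρ)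
  simp only [oscMajorant]
  rw [lintegral_tsum fun _ => (measurable_const.indicator (hmeas _)).aemeasurable]
  gcongr with q
  rw [lintegral_indicator_const (hmeas _)]
  gcongr
  exact prob_nearGrid_le x hr _

namespace IsKernelFamily

variable {δ : ℝ} {ω : Omega d} {t : (ℕ × ℕ) × ℤ → ℝ^d → ℝ^d → ℝ}

theorem swap (ht : IsKernelFamily δ ω t) :
    IsKernelFamily δ ω fun q x y => t (q.1.swap, q.2) y x where
  bound q x y := by
    have h := ht.bound (q.1.swap, q.2) y x
    rwa [norm_sub_rev, weight, Prod.fst_swap, Prod.snd_swap, add_comm] at h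
  left q x x' y h := ht.right (q.1.swap, q.2) y x x' h
  right q x y y' h := ht.left (q.1.swap, q.2) y y' x h
  measurable q := (ht.measurable (q.1.swap, q.2)).comp measurable_swap

theorem tsum_swap (x y : ℝ^d) : ∑' q : (ℕ × ℕ) × ℤ, t (q.1.swap, q.2) y x = ∑' q, t q y x :=
  ((Equiv.prodComm ℕ ℕ).prodCongr (Equiv.refl ℤ)).tsum_eq fun q => t q y x

theorem abs_le (ht : IsKernelFamily δ ω t) (q : (ℕ × ℕ) × ℤ) {x y : ℝ^d} {ρ : ℝ}
    (hρ : ρ ≤ ‖x - y‖) : |t q x y| ≤ weight δ q.1 * cutoff d ρ q.2 :=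
  (ht.bound q x y).trans
    (mul_le_mul_of_nonneg_left (cutoff_anti hρ _) (weight_pos δ q.1).le)

theorem enorm_tsum_le (ht : IsKernelFamily δ ω t) (hd : 1 ≤ d) (hδ : 0 < δ) {x y : ℝ^d} {ρ : ℝ}
    (hρ : 0 < ρ) (hxy : ρ ≤ ‖x - y‖) :
    ‖∑' q, t q x y‖ₑ ≤ ENNReal.ofReal (sizeConst d δ / ρ ^ d) :=
  enorm_tsum_le_tsum_enorm.trans <|
    (ENNReal.tsum_le_tsum fun q =>
      (Real.enorm_eq_ofReal_abs _).trans_le (ENNReal.ofReal_le_ofReal (ht.abs_le q hxy))).trans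
    (tsum_weight_mul_cutoff_le hd hδ hρ)

theorem abs_tsum_le (ht : IsKernelFamily δ ω t) (hd : 1 ≤ d) (hδ : 0 < δ) {x y : ℝ^d} {ρ : ℝ}
    (hρ : 0 < ρ) (hxy : ρ ≤ ‖x - y‖) : |∑' q, t q x y| ≤ sizeConst d δ / ρ ^ d := by
  have h := ht.enorm_tsum_le hd hδ hρ hxy
  rwa [Real.enorm_eq_ofReal_abs, ENNReal.ofReal_le_ofReal_iff
    (div_nonneg (sizeConst_nonneg d δ) (by positivity))] at h

theorem summable (ht : IsKernelFamily δ ω t) (hd : 1 ≤ d) (hδ : 0 < δ) {x y : ℝ^d}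
    (hxy : x ≠ y) : Summable fun q => t q x y :=
  Summable.of_norm_bounded
    (summable_weight_mul_cutoff hd hδ (norm_pos_iff.2 (sub_ne_zero.2 hxy)))
    fun q => ht.bound q x y

theorem enorm_tsum_sub_left_le (ht : IsKernelFamily δ ω t) (hd : 1 ≤ d) (hδ : 0 < δ)
    {x x' y : ℝ^d} {r ρ : ℝ} (hρ : 0 < ρ) (hxx' : ‖x - x'‖ ≤ r) (hxy : ρ ≤ ‖x - y‖)
    (hxy' : ρ ≤ ‖x' - y‖) :
    ‖∑' q, t q x y - ∑' q, t q x' y‖ₑ ≤ oscMajorant δ x r ρ ω := by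
  have hne {z : ℝ^d} (hz : ρ ≤ ‖z - y‖) : z ≠ y := sub_ne_zero.1 (norm_pos_iff.1 (hρ.trans_le hz))
  rw [← (ht.summable hd hδ (hne hxy)).tsum_sub (ht.summable hd hδ (hne hxy'))]
  refine enorm_tsum_le_tsum_enorm.trans (ENNReal.tsum_le_tsum fun q => ?_)
  by_cases hω : ω ∈ nearGrid x r (q.2 - q.1.1 - 1)
  · rw [Set.indicator_of_mem hω, Real.enorm_eq_ofReal_abs]
    refine ENNReal.ofReal_le_ofReal ((abs_sub _ _).trans ?_)
    linarith [ht.abs_le q hxy, ht.abs_le q hxy']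
  · rw [ht.left q x x' y (cubeIdx_eq_of_notMem_nearGrid hω hxx'), sub_self, enorm_zero]
    exact zero_le

theorem enorm_tsum_sub_right_le (ht : IsKernelFamily δ ω t) (hd : 1 ≤ d) (hδ : 0 < δ)
    {x y y' : ℝ^d} {r ρ : ℝ} (hρ : 0 < ρ) (hyy' : ‖y - y'‖ ≤ r) (hxy : ρ ≤ ‖x - y‖)
    (hxy' : ρ ≤ ‖x - y'‖) :
    ‖∑' q, t q x y - ∑' q, t q x y'‖ₑ ≤ oscMajorant δ y r ρ ω := by
  have h := ht.swap.enorm_tsum_sub_left_le hd hδ hρ hyy' (norm_sub_rev x y ▸ hxy)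
    (norm_sub_rev x y' ▸ hxy')
  rwa [tsum_swap, tsum_swap] at h

end IsKernelFamily

theorem norm_mul_le_of_ne_zero {a b c : ℝ} (h : a ≠ 0 → |b| ≤ c) : ‖a * b‖ ≤ c * ‖a‖ := by
  rcases eq_or_ne a 0 with rfl | ha
  · simp only [zero_mul, norm_zero, mul_zero, le_refl]
  · rw [norm_mul, mul_comm]
    exact mul_le_mul_of_nonneg_right (h ha) (norm_nonneg a)

theorem summable_integral_norm_mul {ι α : Type*} [MeasurableSpace α] {μ : Measure α} {w : α → ℝ}
    (hw : Integrable w μ) {s : ι → α → ℝ} {b : ι → ℝ} (hs : ∀ i z, w z ≠ 0 → |s i z| ≤ b i)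
    (hb : Summable b) : Summable fun i => ∫ z, ‖w z * s i z‖ ∂μ := by
  refine Summable.of_nonneg_of_le (fun i => by positivity) (fun i => ?_)
    (hb.mul_right (∫ z, ‖w z‖ ∂μ))
  rw [← integral_const_mul]
  exact integral_mono_of_nonneg (Eventually.of_forall fun z => norm_nonneg _)
    (hw.norm.const_mul _) (Eventually.of_forall fun z => norm_mul_le_of_ne_zero (hs i z))

theorem hasSum_integral_mul {ι α : Type*} [Countable ι] [MeasurableSpace α] {μ : Measure α}
    {w : α → ℝ} (hw : Integrable w μ) {s : ι → α → ℝ} (hm : ∀ i, Measurable (s i)) {b : ι → ℝ}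
    (hs : ∀ i z, w z ≠ 0 → |s i z| ≤ b i) (hb : Summable b) :
    HasSum (fun i => ∫ z, w z * s i z ∂μ) (∫ z, w z * ∑' i, s i z ∂μ) := by
  have h := hasSum_integral_of_summable_integral_norm (F := fun i z => w z * s i z)
    (fun i => (hw.norm.const_mul (b i)).mono'
      (hw.aestronglyMeasurable.mul (hm i).aestronglyMeasurable)
      (Eventually.of_forall fun z => norm_mul_le_of_ne_zero (hs i z)))
    (summable_integral_norm_mul hw hs hb)
  simpa only [tsum_mul_left] using h

theorem IsShiftData.tendsto_sum_integral {ω : Omega d} {m n : ℕ}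
    {hin hout : Cube d → Cube d → ℝ^d → ℝ} (H : IsShiftData ω m n hin hout) {f g : ℝ^d → ℝ}
    (hf : MemLp f 2) (hg : MemLp g 2) (hf1 : Integrable f) (hg1 : Integrable g) {a : ℝ}
    (ha : Tendsto (fun N : ℕ => ∫ x, (∑ k ∈ Finset.Icc (-(N : ℤ)) N,
      scalePart ω m n hin hout k (hf.toLp f) x) * (hg.toLp g) x) atTop (𝓝 a)) :
    Tendsto (fun N : ℕ => ∑ k ∈ Finset.Icc (-(N : ℤ)) N, ∫ z : ℝ^d × ℝ^d,
      f z.2 * g z.1 * scaleKernel ω m n hin hout k z.1 z.2 ∂(volume.prod volume))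
      atTop (𝓝 a) := by
  refine ha.congr fun N => ?_
  calc _ = ∫ x, ∑ k ∈ Finset.Icc (-(N : ℤ)) N, scalePart ω m n hin hout k f x * g x := by
        refine integral_congr_ae (hg.coeFn_toLp.mono fun x hx => ?_)
        simp only [hx, Finset.sum_mul, scalePart_congr_ae ω m n hin hout _ hf.coeFn_toLp]
    _ = _ := by
        rw [integral_finsetSum _ fun k _ => (H.hasIntegral_scalePart_mul k hf1 hg1).1]
        exact Finset.sum_congr rfl fun k _ => (H.hasIntegral_scalePart_mul k hf1 hg1).2

/-- The sum over all scales and complexity types of the kernels `t` represents the weighted sum of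
the operators `𝕊 m n` on separated functions. -/
def Represents (t : (ℕ × ℕ) × ℤ → ℝ^d → ℝ^d → ℝ) (lam : ℕ → ℕ → ℝ)
    (𝕊 : ℕ → ℕ → Lp ℝ 2 (volume : Measure (ℝ^d)) →L[ℝ] Lp ℝ 2 (volume : Measure (ℝ^d))) : Prop :=
  ∀ (f g : ℝ^d → ℝ) (hf : MemLp f 2) (hg : MemLp g 2), Integrable f → Integrable g →
    ∀ ρ > 0, (∀ x y, f y * g x ≠ 0 → ρ ≤ ‖x - y‖) →
    ∑' p : ℕ × ℕ, lam p.1 p.2 * inner ℝ (𝕊 p.1 p.2 (hf.toLp f)) (hg.toLp g) =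
      ∫ z : ℝ^d × ℝ^d, f z.2 * g z.1 * ∑' q, t q z.1 z.2 ∂(volume.prod volume)

theorem exists_isKernelFamily (hd : 1 ≤ d) {δ : ℝ} (hδ : 0 < δ) {ω : Omega d} {lam : ℕ → ℕ → ℝ}
    {𝕊 : ℕ → ℕ → Lp ℝ 2 (volume : Measure (ℝ^d)) →L[ℝ] Lp ℝ 2 (volume : Measure (ℝ^d))}
    (hlam : ∀ m n, |lam m n| ≤ weight δ (m, n)) (hS : ∀ m n, IsHaarShift ω m n (𝕊 m n)) :
    ∃ t : (ℕ × ℕ) × ℤ → ℝ^d → ℝ^d → ℝ, IsKernelFamily δ ω t ∧ Represents t lam 𝕊 := by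
  choose hin hout H hlim using hS
  have H (m n : ℕ) : IsShiftData ω m n (hin m n) (hout m n) := H m n
  let t : (ℕ × ℕ) × ℤ → ℝ^d → ℝ^d → ℝ := fun q x y =>
    lam q.1.1 q.1.2 * scaleKernel ω q.1.1 q.1.2 (hin q.1.1 q.1.2) (hout q.1.1 q.1.2) q.2 x y
  have ht : IsKernelFamily δ ω t :=
    { bound q x y := by
        rw [abs_mul]
        exact mul_le_mul (hlam _ _) ((H _ _).abs_scaleKernel_le _ _ _) (abs_nonneg _)
          (weight_pos _ _).le
      left q x x' y h := congrArg (lam q.1.1 q.1.2 * ·) ((H _ _).scaleKernel_eq_left y h)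
      right q x y y' h := congrArg (lam q.1.1 q.1.2 * ·) ((H _ _).scaleKernel_eq_right x h)
      measurable q := ((H _ _).measurable_scaleKernel _).const_mul _ }
  refine ⟨t, ht, fun f g hf hg hf1 hg1 ρ hρ hsep => ?_⟩
  have hw : Integrable (fun z : ℝ^d × ℝ^d => f z.2 * g z.1) (volume.prod volume) := by
    simpa only [mul_comm] using hg1.mul_prod hf1
  have hsum := hasSum_integral_mul hw ht.measurable
    (fun q z hz => ht.abs_le q (hsep _ _ hz)) (summable_weight_mul_cutoff hd hδ hρ)
  rw [← hsum.tsum_eq, hsum.summable.tsum_prod]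
  refine tsum_congr fun p => ?_
  have hscales := (hsum.summable.prod_factor p).hasSum.comp
    ((Finset.tendsto_Icc_neg_atTop_atTop (α := ℤ)).comp tendsto_natCast_atTop_atTop)
  refine tendsto_nhds_unique (((H p.1 p.2).tendsto_sum_integral hf hg hf1 hg1
    (hlim p.1 p.2 _ _)).const_mul _) (hscales.congr fun N => ?_)
  simp only [Function.comp_apply, Finset.mul_sum, ← integral_const_mul, t, mul_left_comm]

theorem abs_integral_sub_integral_le {Ω : Type*} [MeasurableSpace Ω] {P : Measure Ω} {f g : Ω → ℝ}
    (hf : Integrable f P) (hg : Integrable g P) {M : Ω → ℝ≥0∞} (h : ∀ᵐ ω ∂P, ‖f ω - g ω‖ₑ ≤ M ω)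
    {c : ℝ} (hc : 0 ≤ c) (hM : ∫⁻ ω, M ω ∂P ≤ ENNReal.ofReal c) :
    |∫ ω, f ω ∂P - ∫ ω, g ω ∂P| ≤ c := by
  rw [← integral_sub hf hg, ← ENNReal.ofReal_le_ofReal_iff hc, ← Real.enorm_eq_ofReal_abs]
  exact (enorm_integral_le_lintegral_enorm _).trans ((lintegral_mono_ae h).trans hM)

theorem exists_simpleFunc_dist_lt {α : Type*} [MetricSpace α] [MeasurableSpace α]
    [OpensMeasurableSpace α] {s : Set α} (hs : IsCompact s) (hne : s.Nonempty) {r : ℝ}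
    (hr : 0 < r) : ∃ φ : SimpleFunc α α, (∀ z, φ z ∈ s) ∧ ∀ z ∈ s, dist z (φ z) < r := by
  have : Nonempty s := hne.to_subtype
  have : TopologicalSpace.SeparableSpace s := hs.isSeparable.separableSpace
  let e : ℕ → α := fun n => TopologicalSpace.denseSeq s n
  have hcover : s ⊆ ⋃ n, Metric.ball (e n) r := fun z hz => by
    obtain ⟨n, hn⟩ := (TopologicalSpace.denseRange_denseSeq s).exists_dist_lt ⟨z, hz⟩ hr
    exact Set.mem_iUnion.2 ⟨n, hn⟩
  obtain ⟨t, ht⟩ := hs.elim_finite_subcover _ (fun _ => Metric.isOpen_ball) hcover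
  refine ⟨SimpleFunc.nearestPt e (t.sup id), fun z => Subtype.coe_prop _, fun z hz => ?_⟩
  obtain ⟨n, hn, hzn⟩ := Set.mem_iUnion₂.1 (ht hz)
  have h := SimpleFunc.edist_nearestPt_le e z (Finset.le_sup (f := id) hn)
  rw [← edist_lt_ofReal, edist_comm]
  exact h.trans_lt ((edist_comm _ _).trans_lt (edist_lt_ofReal.2 hzn))

theorem mul_comp_simpleFunc_eq_sum {α β : Type*} [MeasurableSpace α] (w : α → ℝ)
    (φ : SimpleFunc α β) (h : β → ℝ) (z : α) :
    w z * h (φ z) = ∑ b ∈ φ.range, h b * (φ ⁻¹' {b}).indicator w z := by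
  rw [Finset.sum_eq_single_of_mem (φ z) (φ.mem_range_self z) fun b _ hb => ?_]
  · rw [Set.indicator_of_mem (Set.mem_preimage.2 (Set.mem_singleton _)), mul_comm]
  · rw [Set.indicator_of_notMem (show z ∉ φ ⁻¹' {b} from fun hz => hb (Eq.symm hz)), mul_zero]

theorem integrable_mul_comp_simpleFunc {Ω α β : Type*} [MeasurableSpace Ω] {P : Measure Ω}
    [MeasurableSpace α] {ν : Measure α} {w : α → ℝ} (hw : Integrable w ν)
    (φ : SimpleFunc α β) {k : Ω → β → ℝ} (hk : ∀ z, Integrable (fun ω => k ω (φ z)) P) :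
    Integrable (fun p : Ω × α => w p.2 * k p.1 (φ p.2)) (P.prod ν) := by
  simp only [mul_comp_simpleFunc_eq_sum w φ]
  refine integrable_finsetSum _ fun b hb => ?_
  obtain ⟨z, rfl⟩ := SimpleFunc.mem_range.1 hb
  exact (hk z).mul_prod (hw.indicator (φ.measurableSet_fiber _))

theorem enorm_integral_mul_sub_le {α : Type*} [MeasurableSpace α] {ν : Measure α} {w u v : α → ℝ}
    {M : α → ℝ≥0∞} (hu : Integrable (fun z => w z * u z) ν)
    (hv : Integrable (fun z => w z * v z) ν)
    (h : ∀ z, w z ≠ 0 → ‖u z - v z‖ₑ ≤ M z) :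
    ‖∫ z, w z * u z ∂ν - ∫ z, w z * v z ∂ν‖ₑ ≤ ∫⁻ z, ‖w z‖ₑ * M z ∂ν := by
  rw [← integral_sub hu hv]
  refine (enorm_integral_le_lintegral_enorm _).trans (lintegral_mono fun z => ?_)
  rw [← mul_sub, enorm_mul]
  by_cases hz : w z = 0
  · simp only [hz, enorm_zero, zero_mul, le_refl]
  · gcongr
    exact h z hz

theorem enorm_integral_mul_sub_const_le {α : Type*} [MeasurableSpace α] {ν : Measure α}
    {w u : α → ℝ} (hw0 : 0 ≤ w) (hw1 : ∫ z, w z ∂ν = 1) (hu : Integrable (fun z => w z * u z) ν)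
    {c : ℝ} {M : ℝ≥0∞} (h : ∀ z, w z ≠ 0 → ‖u z - c‖ₑ ≤ M) :
    ‖∫ z, w z * u z ∂ν - c‖ₑ ≤ M := by
  have hw : Integrable w ν := .of_integral_ne_zero (hw1 ▸ one_ne_zero)
  have hmass : ∫⁻ z, ‖w z‖ₑ ∂ν = 1 := by
    simp only [← ofReal_integral_norm_eq_lintegral_enorm hw, Real.norm_of_nonneg (hw0 _), hw1,
      ENNReal.ofReal_one]
  calc ‖∫ z, w z * u z ∂ν - c‖ₑ = ‖∫ z, w z * u z ∂ν - ∫ z, w z * c ∂ν‖ₑ := by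
        rw [integral_mul_const, hw1, one_mul]
    _ ≤ ∫⁻ z, ‖w z‖ₑ * M ∂ν := enorm_integral_mul_sub_le hu (hw.mul_const c) h
    _ = M := by rw [lintegral_mul_const'' _ hw.aestronglyMeasurable.enorm, hmass, one_mul]

theorem abs_integral_integral_mul_sub_comp_simpleFunc_le {Ω α : Type*} [MeasurableSpace Ω]
    {P : Measure Ω} [SFinite P] [MeasurableSpace α] {ν : Measure α} [SFinite ν] {w : α → ℝ}
    (hw : Integrable w ν) {k : Ω → α → ℝ} (hwk : ∀ ω, Integrable (fun z => w z * k ω z) ν)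
    (hE : Integrable (fun ω => ∫ z, w z * k ω z ∂ν) P) (φ : SimpleFunc α α)
    (hφ : ∀ z, Integrable (fun ω => k ω (φ z)) P) {M : α → Ω → ℝ≥0∞} (hMm : ∀ z, Measurable (M z))
    {η : ℝ} (hη : 0 ≤ η) (hMP : ∀ z, ∫⁻ ω, M z ω ∂P ≤ ENNReal.ofReal η)
    (hM : ∀ z, w z ≠ 0 → ∀ ω, ‖k ω z - k ω (φ z)‖ₑ ≤ M (φ z) ω) :
    |∫ ω, ∫ z, w z * k ω z ∂ν ∂P - ∫ z, w z * ∫ ω, k ω (φ z) ∂P ∂ν| ≤ η * ∫ z, ‖w z‖ ∂ν := by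
  have hprod := integrable_mul_comp_simpleFunc hw φ hφ
  have hMφ : Measurable fun p : Ω × α => M (φ p.2) p.1 :=
    (φ.comp Prod.snd measurable_snd).measurable_bind _ fun b => (hMm b).comp measurable_fst
  have hswap : ∫ z, w z * ∫ ω, k ω (φ z) ∂P ∂ν = ∫ ω, ∫ z, w z * k ω (φ z) ∂ν ∂P := by
    simp only [← integral_const_mul]
    exact (integral_integral_swap (f := fun ω z => w z * k ω (φ z)) hprod).symm
  rw [hswap]
  refine abs_integral_sub_integral_le hE hprod.integral_prod_left
    (hprod.prod_right_ae.mono fun ω hω => enorm_integral_mul_sub_le (hwk ω) hω (hM · · ω))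
    (by positivity) ?_
  calc ∫⁻ ω, ∫⁻ z, ‖w z‖ₑ * M (φ z) ω ∂ν ∂P
      = ∫⁻ z, ‖w z‖ₑ * ∫⁻ ω, M (φ z) ω ∂P ∂ν := by
        rw [lintegral_lintegral_swap (hw.aestronglyMeasurable.enorm.comp_snd.mul hMφ.aemeasurable)]
        simp only [lintegral_const_mul _ (hMm _)]
    _ ≤ ∫⁻ z, ‖w z‖ₑ * ENNReal.ofReal η ∂ν := by gcongr; exact hMP _
    _ = ENNReal.ofReal (η * ∫ z, ‖w z‖ ∂ν) := by
        rw [lintegral_mul_const' _ _ ENNReal.ofReal_ne_top, mul_comm, ENNReal.ofReal_mul hη,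
          ofReal_integral_norm_eq_lintegral_enorm hw]

section MeanContinuity

variable {Ω α : Type*} [MeasurableSpace Ω] {P : Measure Ω} [MetricSpace α] {k : Ω → α → ℝ}
  {s : Set α}

/-- The random function `k` is uniformly continuous in mean on `s`: its oscillation at small
distances has a majorant of small expectation. Only the majorant has to be measurable. -/
def UniformContinuousInMeanOn (P : Measure Ω) (k : Ω → α → ℝ) (s : Set α) : Prop :=
  ∀ ε > 0, ∃ r > 0, ∃ M : α → Ω → ℝ≥0∞, (∀ z, Measurable (M z)) ∧
    (∀ z, ∫⁻ ω, M z ω ∂P ≤ ENNReal.ofReal ε) ∧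
    ∀ z ∈ s, ∀ z' ∈ s, dist z z' < r → ∀ ω, ‖k ω z - k ω z'‖ₑ ≤ M z' ω

theorem UniformContinuousInMeanOn.mono {s' : Set α} (hk : UniformContinuousInMeanOn P k s)
    (hs : s' ⊆ s) : UniformContinuousInMeanOn P k s' := fun ε hε => by
  obtain ⟨r, hr, M, hMm, hMP, hM⟩ := hk ε hε
  exact ⟨r, hr, M, hMm, hMP, fun z hz z' hz' => hM z (hs hz) z' (hs hz')⟩

theorem UniformContinuousInMeanOn.continuousOn_integral (hk : UniformContinuousInMeanOn P k s)
    (hint : ∀ z ∈ s, Integrable (fun ω => k ω z) P) :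
    ContinuousOn (fun z => ∫ ω, k ω z ∂P) s := by
  refine Metric.continuousOn_iff.2 fun z' hz' ε hε => ?_
  obtain ⟨r, hr, M, -, hMP, hM⟩ := hk (ε / 2) (half_pos hε)
  refine ⟨r, hr, fun z hz hzz' => (?_ : |_| ≤ ε / 2).trans_lt (half_lt_self hε)⟩
  exact abs_integral_sub_integral_le (hint z hz) (hint z' hz') (.of_forall (hM z hz z' hz' hzz'))
    (half_pos hε).le (hMP z')

variable [MeasurableSpace α] {ν : Measure α} {w : α → ℝ}

theorem UniformContinuousInMeanOn.integral_integral_mul [SFinite P] [SFinite ν]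
    [BorelSpace α] (hk : UniformContinuousInMeanOn P k s)
    (hint : ∀ z ∈ s, Integrable (fun ω => k ω z) P) (hs : IsCompact s) (hw : Integrable w ν)
    (hws : Function.support w ⊆ s) (hwk : ∀ ω, Integrable (fun z => w z * k ω z) ν)
    (hE : Integrable (fun ω => ∫ z, w z * k ω z ∂ν) P) :
    Integrable (fun z => w z * ∫ ω, k ω z ∂P) ν ∧
      ∫ ω, ∫ z, w z * k ω z ∂ν ∂P = ∫ z, w z * ∫ ω, k ω z ∂P ∂ν := by
  have hwK : Integrable (fun z => w z * ∫ ω, k ω z ∂P) ν := by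
    refine (integrableOn_iff_integrable_of_support_subset fun z hz => ?_).1
      (hw.integrableOn.mul_continuousOn (hk.continuousOn_integral hint) hs)
    exact hws (left_ne_zero_of_mul hz)
  refine ⟨hwK, ?_⟩
  rcases s.eq_empty_or_nonempty with rfl | hne
  · simp only [Function.support_eq_empty_iff.1 (Set.subset_empty_iff.1 hws), Pi.zero_apply,
      zero_mul, integral_zero]
  set W := ∫ z, ‖w z‖ ∂ν
  have : 0 ≤ W := by positivity
  refine eq_of_forall_dist_le fun ε hε => ?_
  let η := ε / (2 * W + 1)
  have hη : 0 < η := by positivity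
  obtain ⟨r, hr, M, hMm, hMP, hM⟩ := hk η hη
  obtain ⟨φ, hφs, hφ⟩ := exists_simpleFunc_dist_lt hs hne hr
  have hφ (z : α) (hz : w z ≠ 0) : dist z (φ z) < r := hφ z (hws hz)
  have hM (z : α) (hz : w z ≠ 0) := hM z (hws hz) (φ z) (hφs z) (hφ z hz)
  have hintφ (z : α) := hint _ (hφs z)
  have hprod := (integrable_mul_comp_simpleFunc hw φ hintφ).integral_prod_right
  simp only [integral_const_mul] at hprod
  have houter : |∫ ω, ∫ z, w z * k ω z ∂ν ∂P - ∫ z, w z * ∫ ω, k ω (φ z) ∂P ∂ν| ≤ η * W :=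
    abs_integral_integral_mul_sub_comp_simpleFunc_le hw hwk hE φ hintφ hMm hη.le hMP hM
  have hinner : |∫ z, w z * ∫ ω, k ω (φ z) ∂P ∂ν - ∫ z, w z * ∫ ω, k ω z ∂P ∂ν| ≤ η * W := by
    rw [abs_sub_comm, ← integral_sub hwK hprod, ← Real.norm_eq_abs, ← integral_const_mul]
    refine norm_integral_le_of_norm_le (hw.norm.const_mul η) (.of_forall fun z => ?_)
    rw [← mul_sub]
    exact norm_mul_le_of_ne_zero fun hz => abs_integral_sub_integral_le (hint z (hws hz)) (hintφ z)
      (.of_forall (hM z hz)) hη.le (hMP _)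
  calc _ ≤ η * W + η * W := (abs_sub_le _ _ _).trans (add_le_add houter hinner)
    _ = ε * (2 * W / (2 * W + 1)) := by ring
    _ ≤ ε := mul_le_of_le_one_right hε.le ((div_le_one (by positivity)).2 (by linarith))

theorem aemeasurable_of_forall_exists_enorm_sub_le {κ : Ω → ℝ}
    (h : ∀ ε > 0, ∃ (u : Ω → ℝ) (M : Ω → ℝ≥0∞), AEMeasurable u P ∧ AEMeasurable M P ∧
      ∫⁻ ω, M ω ∂P ≤ ENNReal.ofReal ε ∧ ∀ ω, ‖u ω - κ ω‖ₑ ≤ M ω) : AEMeasurable κ P := by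
  choose u M hu hMm hM huM using fun n : ℕ => h (1 / (n + 1)) Nat.one_div_pos_of_nat
  refine TendstoInMeasure.aemeasurable hu (u := atTop)
    (tendstoInMeasure_of_ne_top fun ε hε hε' => ?_)
  have hlim : Tendsto (fun n : ℕ => ENNReal.ofReal (1 / (n + 1)) / ε) atTop (𝓝 0) := by
    simpa only [ENNReal.ofReal_zero, ENNReal.zero_div] using ENNReal.Tendsto.div_const
      (ENNReal.tendsto_ofReal tendsto_one_div_add_atTop_nhds_zero_nat) (.inr hε.ne')
  refine tendsto_of_tendsto_of_tendsto_of_le_of_le tendsto_const_nhds hlim (fun _ => zero_le)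
    fun n => ?_
  calc P {ω | ε ≤ edist (u n ω) (κ ω)} ≤ P {ω | ε ≤ M n ω} :=
        measure_mono fun ω hω => le_trans hω ((edist_eq_enorm_sub _ _).trans_le (huM n ω))
    _ ≤ (∫⁻ ω, M n ω ∂P) / ε := meas_ge_le_lintegral_div (hMm n) hε.ne' hε'
    _ ≤ ENNReal.ofReal (1 / (n + 1)) / ε := ENNReal.div_le_div_right (hM n) ε

theorem UniformContinuousInMeanOn.aemeasurable (hk : UniformContinuousInMeanOn P k s) {z₀ : α}
    (hz₀ : z₀ ∈ s) (hw : ∀ r > 0, ∃ w : α → ℝ, 0 ≤ w ∧ ∫ z, w z ∂ν = 1 ∧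
      (∀ z, w z ≠ 0 → z ∈ s ∧ dist z z₀ < r) ∧ (∀ ω, Integrable (fun z => w z * k ω z) ν) ∧
      AEMeasurable (fun ω => ∫ z, w z * k ω z ∂ν) P) :
    AEMeasurable (fun ω => k ω z₀) P := by
  refine aemeasurable_of_forall_exists_enorm_sub_le fun ε hε => ?_
  obtain ⟨r, hr, M, hMm, hMP, hM⟩ := hk ε hε
  obtain ⟨w, hw0, hw1, hws, hwk, hm⟩ := hw r hr
  exact ⟨_, M z₀, hm, (hMm z₀).aemeasurable, hMP z₀, fun ω =>
    enorm_integral_mul_sub_const_le hw0 hw1 (hwk ω) fun z hz =>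
      hM z (hws z hz).1 z₀ hz₀ (hws z hz).2 ω⟩

end MeanContinuity

/-- The kernel of the averaged operator: the expectation of the sums of the kernel families of the
random operators. -/
def averageKernel (t : Omega d → (ℕ × ℕ) × ℤ → ℝ^d → ℝ^d → ℝ) (x y : ℝ^d) : ℝ :=
  ∫ ω, ∑' q, t ω q x y ∂prob d

theorem IsKernelFamily.integrable_mul_tsum {δ : ℝ} {ω : Omega d}
    {t : (ℕ × ℕ) × ℤ → ℝ^d → ℝ^d → ℝ} (ht : IsKernelFamily δ ω t) (hd : 1 ≤ d) (hδ : 0 < δ)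
    {w : ℝ^d × ℝ^d → ℝ} (hw : Integrable w (volume.prod volume)) {ρ : ℝ} (hρ : 0 < ρ)
    (hsep : ∀ z, w z ≠ 0 → ρ ≤ ‖z.1 - z.2‖) :
    Integrable (fun z => w z * ∑' q, t q z.1 z.2) (volume.prod volume) :=
  (hw.norm.const_mul (sizeConst d δ / ρ ^ d)).mono'
    (hw.aestronglyMeasurable.mul (Measurable.tsum ht.measurable).aestronglyMeasurable)
    (.of_forall fun z => norm_mul_le_of_ne_zero fun hz => ht.abs_tsum_le hd hδ hρ (hsep z hz))

theorem exists_bump (c : ℝ^d) {a : ℝ} (ha : 0 < a) :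
    ∃ b : ℝ^d → ℝ, 0 ≤ b ∧ ∫ z, b z = 1 ∧ (∀ p, MemLp b p) ∧ ∀ z, b z ≠ 0 → dist z c < a := by
  let b : ContDiffBump c := ⟨a / 2, a, half_pos ha, half_lt_self ha⟩
  exact ⟨b.normed volume, b.nonneg_normed, b.integral_normed, fun p =>
    b.continuous_normed.memLp_of_hasCompactSupport b.hasCompactSupport_normed,
    fun z hz => b.support_normed_eq.subset hz⟩

theorem integrable_of_bounded_of_hasCompactSupport {α : Type*} [TopologicalSpace α]
    [MeasurableSpace α] {ν : Measure α} [IsFiniteMeasureOnCompacts ν]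
    {f : α → ℝ} (hf : AEStronglyMeasurable f ν) {B : ℝ} (hB : ∀ x, |f x| ≤ B)
    (hc : HasCompactSupport f) : Integrable f ν :=
  (Measure.integrableOn_of_bounded hc.isCompact.measure_lt_top.ne hf
    (.of_forall hB)).integrable_of_forall_notMem_eq_zero fun _ => image_eq_zero_of_notMem_tsupport

theorem exists_pos_le_norm_sub {E : Type*} [SeminormedAddCommGroup E] {s t : Set E}
    (hs : IsCompact s) (ht : IsClosed t) (hst : Disjoint s t) :
    ∃ ρ > 0, ∀ x ∈ s, ∀ y ∈ t, ρ ≤ ‖x - y‖ := by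
  obtain ⟨ρ, hρ, hsep⟩ := Metric.exists_pos_forall_lt_edist hs ht hst
  refine ⟨ρ, hρ, fun x hx y hy => ?_⟩
  rw [← dist_eq_norm, dist_nndist, NNReal.coe_le_coe, ← ENNReal.coe_le_coe, ← edist_nndist]
  exact (hsep x hx y hy).le

section Average

variable {δ : ℝ} {t : Omega d → (ℕ × ℕ) × ℤ → ℝ^d → ℝ^d → ℝ}

theorem abs_averageKernel_le (ht : ∀ ω, IsKernelFamily δ ω (t ω)) (hd : 1 ≤ d) (hδ : 0 < δ)
    {x y : ℝ^d} (hxy : x ≠ y) : |averageKernel t x y| ≤ sizeConst d δ / ‖x - y‖ ^ d := by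
  have hpos : 0 < ‖x - y‖ := norm_pos_iff.2 (sub_ne_zero.2 hxy)
  have hbound (ω : Omega d) : ‖∑' q, t ω q x y‖ ≤ sizeConst d δ / ‖x - y‖ ^ d :=
    (ht ω).abs_tsum_le hd hδ hpos le_rfl
  simpa only [averageKernel, Real.norm_eq_abs, probReal_univ, mul_one] using
    norm_integral_le_of_norm_le_const (μ := prob d) (.of_forall hbound)

theorem exists_lintegral_oscMajorant_le (hd : 1 ≤ d) (hδ0 : 0 < δ) (hδ1 : δ < 1) {ρ ε : ℝ}
    (hρ : 0 < ρ) (hε : 0 < ε) : ∃ r > 0, r ≤ ρ ∧ ∀ x : ℝ^d,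
      ∫⁻ ω, oscMajorant δ x r ρ ω ∂prob d ≤ ENNReal.ofReal ε := by
  have hcont : Continuous fun r : ℝ => smoothConst d δ * r ^ δ / ρ ^ (δ + d) :=
    ((Real.continuous_rpow_const hδ0.le).const_mul _).div_const _
  have hlim : Tendsto (fun r : ℝ => smoothConst d δ * r ^ δ / ρ ^ (δ + d)) (𝓝[>] 0) (𝓝 0) := by
    have h := hcont.tendsto 0
    rw [Real.zero_rpow hδ0.ne', mul_zero, zero_div] at h
    exact h.mono_left nhdsWithin_le_nhds
  obtain ⟨r, hrε, hr, hrρ⟩ :=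
    ((hlim.eventually_le_const hε).and (Ioc_mem_nhdsGT hρ)).exists
  exact ⟨r, hr, hrρ, fun x =>
    (lintegral_oscMajorant_le hd hδ0 hδ1 x hr hρ).trans (ENNReal.ofReal_le_ofReal hrε)⟩

theorem uniformContinuousInMeanOn_tsum (hd : 1 ≤ d) (hδ0 : 0 < δ) (hδ1 : δ < 1)
    (ht : ∀ ω, IsKernelFamily δ ω (t ω)) {ρ : ℝ} (hρ : 0 < ρ) :
    UniformContinuousInMeanOn (prob d) (fun ω (z : ℝ^d × ℝ^d) => ∑' q, t ω q z.1 z.2)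
      {z | ρ ≤ ‖z.1 - z.2‖} := by
  intro ε hε
  obtain ⟨r, hr, hrρ, hosc⟩ :=
    exists_lintegral_oscMajorant_le hd hδ0 hδ1 (half_pos hρ) (half_pos hε)
  refine ⟨r, hr, fun z ω => oscMajorant δ z.1 r (ρ / 2) ω + oscMajorant δ z.2 r (ρ / 2) ω,
    fun z => (measurable_oscMajorant ..).add (measurable_oscMajorant ..), fun z => ?_, ?_⟩
  · rw [lintegral_add_left (measurable_oscMajorant ..), ← add_halves ε,
      ENNReal.ofReal_add (half_pos hε).le (half_pos hε).le]
    exact add_le_add (hosc z.1) (hosc z.2)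
  · rintro ⟨x, y⟩ (hxy : ρ ≤ ‖x - y‖) ⟨x', y'⟩ (hxy' : ρ ≤ ‖x' - y'‖) hdist ω
    obtain ⟨hxx', hyy'⟩ : ‖x' - x‖ < r ∧ ‖y' - y‖ < r := by
      rwa [Prod.dist_eq, max_lt_iff, dist_comm, dist_comm y, dist_eq_norm, dist_eq_norm] at hdist
    have hx'y : ρ / 2 ≤ ‖x' - y‖ := by
      have := norm_sub_le_norm_sub_add_norm_sub x' y y'
      linarith [norm_sub_rev y y']
    have hleft := (ht ω).enorm_tsum_sub_left_le hd hδ0 (half_pos hρ) hxx'.le hx'y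
      ((half_le_self hρ.le).trans hxy)
    have hright := (ht ω).enorm_tsum_sub_right_le hd hδ0 (half_pos hρ) hyy'.le
      ((half_le_self hρ.le).trans hxy') hx'y
    rw [enorm_sub_rev] at hleft hright
    simpa only [sub_add_sub_cancel] using (enorm_add_le _ _).trans (add_le_add hleft hright)

/-- For every `ω` the kernels `t ω` represent the weighted sum of the operators `𝕊 ω m n`, and this
sum is weakly measurable in `ω`. -/
structure IsRandomKernelFamily (δ : ℝ) (t : Omega d → (ℕ × ℕ) × ℤ → ℝ^d → ℝ^d → ℝ)
    (lam : Omega d → ℕ → ℕ → ℝ)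
    (𝕊 : Omega d → ℕ → ℕ → Lp ℝ 2 (volume : Measure (ℝ^d)) →L[ℝ] Lp ℝ 2 (volume : Measure (ℝ^d))) :
    Prop where
  family : ∀ ω, IsKernelFamily δ ω (t ω)
  represents : ∀ ω, Represents (t ω) (lam ω) (𝕊 ω)
  aemeasurable : ∀ f g : Lp ℝ 2 (volume : Measure (ℝ^d)), AEMeasurable
    (fun ω => ∑' p : ℕ × ℕ, lam ω p.1 p.2 * inner ℝ (𝕊 ω p.1 p.2 f) g) (prob d)

namespace IsRandomKernelFamily

variable {lam : Omega d → ℕ → ℕ → ℝ}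
  {𝕊 : Omega d → ℕ → ℕ → Lp ℝ 2 (volume : Measure (ℝ^d)) →L[ℝ] Lp ℝ 2 (volume : Measure (ℝ^d))}

theorem aemeasurable_integral_mul_tsum (h : IsRandomKernelFamily δ t lam 𝕊) {f g : ℝ^d → ℝ}
    (hf : MemLp f 2) (hg : MemLp g 2) (hf1 : Integrable f) (hg1 : Integrable g) {ρ : ℝ}
    (hρ : 0 < ρ) (hsep : ∀ x y, f y * g x ≠ 0 → ρ ≤ ‖x - y‖) :
    AEMeasurable (fun ω => ∫ z : ℝ^d × ℝ^d, f z.2 * g z.1 * ∑' q, t ω q z.1 z.2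
      ∂(volume.prod volume)) (prob d) :=
  (h.aemeasurable (hf.toLp f) (hg.toLp g)).congr
    (.of_forall fun ω => h.represents ω f g hf hg hf1 hg1 ρ hρ hsep)

theorem integrable_integral_mul_tsum (h : IsRandomKernelFamily δ t lam 𝕊) (hd : 1 ≤ d)
    (hδ : 0 < δ) {f g : ℝ^d → ℝ} (hf : MemLp f 2) (hg : MemLp g 2) (hf1 : Integrable f)
    (hg1 : Integrable g) {ρ : ℝ} (hρ : 0 < ρ) (hsep : ∀ x y, f y * g x ≠ 0 → ρ ≤ ‖x - y‖) :
    Integrable (fun ω => ∫ z : ℝ^d × ℝ^d, f z.2 * g z.1 * ∑' q, t ω q z.1 z.2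
      ∂(volume.prod volume)) (prob d) := by
  have hw : Integrable (fun z : ℝ^d × ℝ^d => f z.2 * g z.1) (volume.prod volume) := by
    simpa only [mul_comm] using hg1.mul_prod hf1
  exact .of_bound (h.aemeasurable_integral_mul_tsum hf hg hf1 hg1 hρ hsep).aestronglyMeasurable _
    (.of_forall fun ω => norm_integral_le_of_norm_le (hw.norm.const_mul (sizeConst d δ / ρ ^ d))
      (.of_forall fun z => norm_mul_le_of_ne_zero fun hz =>
        (h.family ω).abs_tsum_le hd hδ hρ (hsep _ _ hz)))

theorem aemeasurable_tsum (h : IsRandomKernelFamily δ t lam 𝕊) (hd : 1 ≤ d) (hδ0 : 0 < δ)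
    (hδ1 : δ < 1) {x y : ℝ^d} (hxy : x ≠ y) :
    AEMeasurable (fun ω => ∑' q, t ω q x y) (prob d) := by
  have hpos : 0 < ‖x - y‖ := norm_pos_iff.2 (sub_ne_zero.2 hxy)
  have hρ : 0 < ‖x - y‖ / 2 := half_pos hpos
  refine (uniformContinuousInMeanOn_tsum hd hδ0 hδ1 h.family hρ).aemeasurable (z₀ := (x, y))
    (ν := volume.prod volume) (half_le_self hpos.le) fun r hr => ?_
  obtain ⟨a, ha, har, haρ⟩ : ∃ a > 0, a ≤ r ∧ a ≤ ‖x - y‖ / 4 :=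
    ⟨min r (‖x - y‖ / 4), lt_min hr (by positivity), min_le_left .., min_le_right ..⟩
  obtain ⟨f, hf0, hf_one, hf, hfy⟩ := exists_bump y ha
  obtain ⟨g, hg0, hg_one, hg, hgx⟩ := exists_bump x ha
  have hf1 : Integrable f := memLp_one_iff_integrable.1 (hf 1)
  have hg1 : Integrable g := memLp_one_iff_integrable.1 (hg 1)
  have hw : Integrable (fun z : ℝ^d × ℝ^d => f z.2 * g z.1) (volume.prod volume) := by
    simpa only [mul_comm] using hg1.mul_prod hf1
  have hmass : ∫ z : ℝ^d × ℝ^d, f z.2 * g z.1 ∂(volume.prod volume) = 1 := by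
    simp only [mul_comm (f _), integral_prod_mul, hf_one, hg_one, one_mul]
  have hnear (x' y' : ℝ^d) (h : f y' * g x' ≠ 0) :
      ‖x - y‖ / 2 ≤ ‖x' - y'‖ ∧ dist (x', y') (x, y) < r := by
    have hx := hgx x' (right_ne_zero_of_mul h)
    have hy := hfy y' (left_ne_zero_of_mul h)
    refine ⟨?_, max_lt (hx.trans_le har) (hy.trans_le har)⟩
    have := dist_triangle4 x x' y' y
    rw [dist_comm x x', dist_eq_norm x y, dist_eq_norm x' y'] at this
    linarith
  exact ⟨fun z => f z.2 * g z.1, fun z => mul_nonneg (hf0 _) (hg0 _), hmass,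
    fun z => hnear z.1 z.2,
    fun ω => (h.family ω).integrable_mul_tsum hd hδ0 hw hρ fun z hz => (hnear _ _ hz).1,
    h.aemeasurable_integral_mul_tsum (hf 2) (hg 2) hf1 hg1 hρ fun x' y' h => (hnear x' y' h).1⟩

theorem integrable_tsum (h : IsRandomKernelFamily δ t lam 𝕊) (hd : 1 ≤ d) (hδ0 : 0 < δ)
    (hδ1 : δ < 1) {x y : ℝ^d} (hxy : x ≠ y) :
    Integrable (fun ω => ∑' q, t ω q x y) (prob d) :=
  .of_bound (h.aemeasurable_tsum hd hδ0 hδ1 hxy).aestronglyMeasurable _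
    (.of_forall fun ω =>
      (h.family ω).abs_tsum_le hd hδ0 (norm_pos_iff.2 (sub_ne_zero.2 hxy)) le_rfl)

theorem isStandardKernel_averageKernel (h : IsRandomKernelFamily δ t lam 𝕊) (hd : 1 ≤ d)
    (hδ0 : 0 < δ) (hδ1 : δ < 1) :
    IsStandardKernel (1 + sizeConst d δ + 2 * (smoothConst d δ * 2 ^ (δ + d))) δ
      (averageKernel t) := by
  have hsize := sizeConst_nonneg d δ
  have hsmooth := smoothConst_nonneg d δ
  have hint {x y : ℝ^d} (hxy : x ≠ y) := h.integrable_tsum hd hδ0 hδ1 hxy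
  refine ⟨fun x y hxy => (abs_averageKernel_le h.family hd hδ0 hxy).trans ?_,
    fun x x' y hxy hx' => ?_⟩
  · gcongr
    have : 0 ≤ smoothConst d δ * 2 ^ (δ + d) := by positivity
    linarith
  rcases eq_or_ne x x' with rfl | hne
  · simp only [sub_self, abs_zero, add_zero]
    positivity
  have hpos : 0 < ‖x - y‖ := norm_pos_iff.2 (sub_ne_zero.2 hxy)
  have hx'y : ‖x - y‖ / 2 ≤ ‖x' - y‖ := by
    linarith [norm_sub_le_norm_sub_add_norm_sub x x' y]
  have hxy' := half_le_self hpos.le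
  have hx'y_ne : x' ≠ y := sub_ne_zero.1 (norm_pos_iff.1 ((half_pos hpos).trans_le hx'y))
  have hosc := lintegral_oscMajorant_le hd hδ0 hδ1 x (norm_pos_iff.2 (sub_ne_zero.2 hne))
    (half_pos hpos)
  have hleft := abs_integral_sub_integral_le (hint hxy) (hint hx'y_ne) (.of_forall fun ω =>
    (h.family ω).enorm_tsum_sub_left_le hd hδ0 (half_pos hpos) le_rfl hxy' hx'y)
    (by positivity) hosc
  have hright := abs_integral_sub_integral_le (hint hxy.symm) (hint hx'y_ne.symm)
    (.of_forall fun ω => (h.family ω).enorm_tsum_sub_right_le hd hδ0 (half_pos hpos) le_rfl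
      (norm_sub_rev x y ▸ hxy') (norm_sub_rev x' y ▸ hx'y)) (by positivity) hosc
  calc _ ≤ _ := add_le_add hleft hright
    _ = 2 * (smoothConst d δ * 2 ^ (δ + d)) * ‖x - x'‖ ^ δ / ‖x - y‖ ^ (δ + d) := by
        rw [Real.div_rpow hpos.le zero_le_two]
        field_simp
        norm_num
    _ ≤ _ := by
        gcongr
        linarith

theorem isRepresentedBy_averageKernel (h : IsRandomKernelFamily δ t lam 𝕊) (hd : 1 ≤ d)
    (hδ0 : 0 < δ) (hδ1 : δ < 1)
    {S : Lp ℝ 2 (volume : Measure (ℝ^d)) →L[ℝ] Lp ℝ 2 (volume : Measure (ℝ^d))}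
    (hS : ∀ f g, inner ℝ (S f) g =
      ∫ ω, ∑' p : ℕ × ℕ, lam ω p.1 p.2 * inner ℝ (𝕊 ω p.1 p.2 f) g ∂prob d) :
    IsRepresentedBy S (averageKernel t) := by
  rintro f g hf hg ⟨Bf, hBf⟩ ⟨Bg, hBg⟩ hfc hgc hdisj
  have hf1 := integrable_of_bounded_of_hasCompactSupport hf.aestronglyMeasurable hBf hfc
  have hg1 := integrable_of_bounded_of_hasCompactSupport hg.aestronglyMeasurable hBg hgc
  obtain ⟨ρ, hρ, hsep⟩ := exists_pos_le_norm_sub hgc.isCompact (isClosed_tsupport f) hdisj.symm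
  have hsupp {x y : ℝ^d} (hxy : f y * g x ≠ 0) : x ∈ tsupport g ∧ y ∈ tsupport f :=
    ⟨subset_tsupport g (right_ne_zero_of_mul hxy), subset_tsupport f (left_ne_zero_of_mul hxy)⟩
  have hsep' (x y : ℝ^d) (hxy : f y * g x ≠ 0) : ρ ≤ ‖x - y‖ :=
    hsep x (hsupp hxy).1 y (hsupp hxy).2
  have hw : Integrable (fun z : ℝ^d × ℝ^d => f z.2 * g z.1) (volume.prod volume) := by
    simpa only [mul_comm] using hg1.mul_prod hf1
  have hne {x y : ℝ^d} (hxy : ρ ≤ ‖x - y‖) : x ≠ y :=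
    sub_ne_zero.1 (norm_pos_iff.1 (hρ.trans_le hxy))
  have hcont := (uniformContinuousInMeanOn_tsum hd hδ0 hδ1 h.family hρ).mono
    (fun z hz => hsep z.1 hz.1 z.2 hz.2 : tsupport g ×ˢ tsupport f ⊆ {z | ρ ≤ ‖z.1 - z.2‖})
  obtain ⟨hK, hexch⟩ := hcont.integral_integral_mul
    (fun z hz => h.integrable_tsum hd hδ0 hδ1 (hne (hsep z.1 hz.1 z.2 hz.2)))
    (hgc.isCompact.prod hfc.isCompact) hw (fun z hz => hsupp hz)
    (fun ω => (h.family ω).integrable_mul_tsum hd hδ0 hw hρ fun z => hsep' z.1 z.2)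
    (h.integrable_integral_mul_tsum hd hδ0 hf hg hf1 hg1 hρ hsep')
  refine ⟨hK, ?_⟩
  calc inner ℝ (S (hf.toLp f)) (hg.toLp g)
      = ∫ ω, ∫ z : ℝ^d × ℝ^d, f z.2 * g z.1 * ∑' q, t ω q z.1 z.2
          ∂(volume.prod volume) ∂prob d := by
        simp only [hS, h.represents _ f g hf hg hf1 hg1 ρ hρ hsep']
    _ = ∫ y, ∫ x, f y * g x * averageKernel t x y := hexch.trans (integral_prod_symm _ hK)

end IsRandomKernelFamily

end Average

theorem exists_inner_eq_integral_inner {Ω H : Type*} [MeasurableSpace Ω] {P : Measure Ω}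
    [IsFiniteMeasure P] [NormedAddCommGroup H] [InnerProductSpace ℝ H] [CompleteSpace H]
    {T : Ω → H →L[ℝ] H} {C : ℝ} (hT : ∀ ω, ‖T ω‖ ≤ C)
    (hmeas : ∀ f g, AEMeasurable (fun ω => inner ℝ (T ω f) g) P) :
    ∃ S : H →L[ℝ] H, ∀ f g, inner ℝ (S f) g = ∫ ω, inner ℝ (T ω f) g ∂P := by
  have hbound (f g : H) (ω : Ω) : ‖inner ℝ (T ω f) g‖ ≤ C * ‖f‖ * ‖g‖ :=
    (norm_inner_le_norm _ _).trans
      (mul_le_mul_of_nonneg_right ((T ω).le_of_opNorm_le (hT ω) f) (norm_nonneg g))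
  have hint (f g : H) : Integrable (fun ω => inner ℝ (T ω f) g) P :=
    .of_bound (hmeas f g).aestronglyMeasurable _ (.of_forall (hbound f g))
  let B : H →ₗ⋆[ℝ] H →ₗ[ℝ] ℝ := LinearMap.mk₂'ₛₗ (starRingEnd ℝ) (RingHom.id ℝ)
    (fun f g => ∫ ω, inner ℝ (T ω f) g ∂P)
    (fun f f' g => by
      simp only [map_add, inner_add_left, integral_add (hint f g) (hint f' g)])
    (fun c f g => by
      simp only [map_smul, real_inner_smul_left, integral_const_mul, smul_eq_mul, conj_trivial])
    (fun f g g' => by simp only [inner_add_right, integral_add (hint f g) (hint f g')])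
    (fun c f g => by
      simp only [real_inner_smul_right, integral_const_mul, smul_eq_mul, RingHom.id_apply])
  have hB (f g : H) : ‖B f g‖ ≤ C * P.real Set.univ * ‖f‖ * ‖g‖ :=
    (norm_integral_le_of_norm_le_const (.of_forall (hbound f g))).trans_eq (by ring)
  exact ⟨InnerProductSpace.continuousLinearMapOfBilin (B.mkContinuous₂ _ hB), fun f g =>
    InnerProductSpace.continuousLinearMapOfBilin_apply (B.mkContinuous₂ _ hB) f g⟩

theorem exists_inner_eq_integral_tsum {Ω H : Type*} [MeasurableSpace Ω] {P : Measure Ω}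
    [IsFiniteMeasure P] [NormedAddCommGroup H] [InnerProductSpace ℝ H] [CompleteSpace H]
    {ι : Type*} {b : ι → ℝ} (hb : Summable b) {a : Ω → ι → ℝ} (ha : ∀ ω i, |a ω i| ≤ b i)
    {T : Ω → ι → H →L[ℝ] H} (hT : ∀ ω i, ‖T ω i‖ ≤ 1)
    (hmeas : ∀ f g, AEMeasurable (fun ω => ∑' i, a ω i * inner ℝ (T ω i f) g) P) :
    ∃ S : H →L[ℝ] H, ∀ f g, inner ℝ (S f) g = ∫ ω, ∑' i, a ω i * inner ℝ (T ω i f) g ∂P := by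
  have hle (ω : Ω) (i : ι) : ‖a ω i • T ω i‖ ≤ b i := by
    rw [norm_smul]
    exact (mul_le_of_le_one_right (norm_nonneg _) (hT ω i)).trans (ha ω i)
  have hinner (f g : H) (ω : Ω) :
      inner ℝ ((∑' i, a ω i • T ω i) f) g = ∑' i, a ω i * inner ℝ (T ω i f) g := by
    have hsum := (Summable.of_norm_bounded hb (hle ω)).hasSum
    have h := (hsum.mapL (ContinuousLinearMap.apply ℝ H f)).mapL (innerSL ℝ g)
    simpa [real_inner_comm, real_inner_smul_left] using h.tsum_eq.symm
  simp only [← hinner] at hmeas ⊢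
  exact exists_inner_eq_integral_inner (fun ω => tsum_of_norm_bounded hb.hasSum (hle ω)) hmeas

end HaarShift

end

theorem theorem3p1 (d : ℕ) (hd : 1 ≤ d) (δ : ℝ) (hδ0 : 0 < δ) (hδ1 : δ < 1) :
    ∃ C : ℝ, 0 < C ∧
      ∀ (lam : HaarShift.Omega d → ℕ → ℕ → ℝ)
        (𝕊 : HaarShift.Omega d → ℕ → ℕ →
          (Lp ℝ 2 (volume : Measure (EuclideanSpace ℝ (Fin d))) →L[ℝ]
            Lp ℝ 2 (volume : Measure (EuclideanSpace ℝ (Fin d))))),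
        (∀ ω m n, |lam ω m n| ≤ (2 : ℝ) ^ (-(((m : ℝ) + n) * δ))) →
        (∀ ω m n, HaarShift.IsHaarShift ω m n (𝕊 ω m n)) →
        (∀ ω m n, ‖𝕊 ω m n‖ ≤ 1) →
        (∀ f g : Lp ℝ 2 (volume : Measure (EuclideanSpace ℝ (Fin d))),
          AEMeasurable (fun ω => ∑' p : ℕ × ℕ, lam ω p.1 p.2 * inner ℝ (𝕊 ω p.1 p.2 f) g)
            (HaarShift.prob d)) →
        ∃ S : Lp ℝ 2 (volume : Measure (EuclideanSpace ℝ (Fin d))) →L[ℝ]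
            Lp ℝ 2 (volume : Measure (EuclideanSpace ℝ (Fin d))),
          (∀ f g : Lp ℝ 2 (volume : Measure (EuclideanSpace ℝ (Fin d))),
            inner ℝ (S f) g =
              ∫ ω, ∑' p : ℕ × ℕ, lam ω p.1 p.2 * inner ℝ (𝕊 ω p.1 p.2 f) g ∂(HaarShift.prob d)) ∧
          HaarShift.IsCalderonZygmund C δ S := by
  have hsize := HaarShift.sizeConst_nonneg d δ
  have hsmooth := HaarShift.smoothConst_nonneg d δ
  refine ⟨1 + HaarShift.sizeConst d δ + 2 * (HaarShift.smoothConst d δ * 2 ^ (δ + d)),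
    by positivity, fun lam 𝕊 hlam hshift hnorm hmeas => ?_⟩
  obtain ⟨S, hS⟩ := HaarShift.exists_inner_eq_integral_tsum (HaarShift.summable_weight hδ0)
    (fun ω p => hlam ω p.1 p.2) (fun ω p => hnorm ω p.1 p.2) hmeas
  choose t ht hrep using fun ω => HaarShift.exists_isKernelFamily hd hδ0 (hlam ω) (hshift ω)
  have h : HaarShift.IsRandomKernelFamily δ t lam 𝕊 := ⟨ht, hrep, hmeas⟩
  exact ⟨S, hS, HaarShift.averageKernel t, h.isStandardKernel_averageKernel hd hδ0 hδ1,
    h.isRepresentedBy_averageKernel hd hδ0 hδ1 hS⟩
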